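/- Let $1<\alpha<\beta$, $I_-=(-\infty,0)$, $I_0=(1,\alpha)$, $I_+=(\beta,\infty)$ and $\Omega=I_-\cup I_0\cup I_+$. Write $e(x)=e^{2\pi i x}$. Let $0<w\le 1$, $\theta,\phi,\psi\in\mathbb R$, and $$B=\begin{pmatrix} w\,e(\phi) & -\sqrt{1-w^2}\,e(\theta-\psi)\\ \sqrt{1-w^2}\,e(\psi) & w\,e(\theta-\phi)\end{pmatrix}\in U(2).$$ Let $P_B$ be the selfadjoint operator $f\mapsto\frac1{2\pi i}f'$ in $L^2(\Omega)$ whose domain consists of the $f\in L^2(\Omega)$ that are locally absolutely continuous on $\overline\Omega=(-\infty,0]\cup[1,\alpha]\cup[\beta,\infty)$, with $f'\in L^2(\Omega)$ and $B\binom{f(1)}{f(\beta)}=\binom{f(0)}{f(\alpha)}$. Then $P_B$ generates a unique strongly continuous unitary one-parameter group $U_B(t)=e^{-2\pi i tP_B}$, $t\in\mathbb R$ (the infinitesimal generator is exactly $-2\pi iP_B$). For $\lambda\in\mathbb R$ put $$a(\lambda)=w^{-1}e(\phi)e(\lambda)\bigl(1-\sqrt{1-w^2}\,e(-\psi+(\alpha-1)\lambda)\bigr),$$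 $$c(\lambda)=w^{-1}e(\phi-\theta)e(-(\beta-\alpha)\lambda)\bigl(1-\sqrt{1-w^2}\,e(\psi-(\alpha-1)\lambda)\bigr),$$ $\psi_\lambda(x)=\bigl(a(\lambda)\chi_{I_-}(x)+\chi_{I_0}(x)+c(\lambda)\chi_{I_+}(x)\bigr)e(\lambda x)$, $\psi_{\lambda,+}=c(\lambda)^{-1}\psi_\lambda$ and $\psi_{\lambda,-}=a(\lambda)^{-1}\psi_\lambda$. For each sign there is a unique bounded operator $V_\pm:L^2(\Omega)\to L^2(\mathbb R)$ with $$(V_\pm f)(\lambda)=\int_\Omega\overline{\psi_{\lambda,\pm}(x)}\,f(x)\,dx\quad\text{for a.e. }\lambda,\qquad f\in L^1(\Omega)\cap L^2(\Omega).$$ Let $\mathcal F$ be the unitary Fourier transform of $L^2(\mathbb R)$, $(\mathcal Ff)(\lambda)=\int f(x)e(-\lambda x)\,dx$, let $R_\pm=\mathcal F^*V_\pm$, let $(U_0(t)f)(x)=f(x-t)$ on $L^2(\mathbb R)$, and let $D_\pm=L^2(I_\pm)\subset L^2(\Omega)$. **Theorem 5.3.** For each of the two signs, $R_\pm$ is a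 unitary operator from $L^2(\Omega)$ onto $L^2(\mathbb R)$. Moreover: 1. $R_\pm$ restricted to $D_\pm$ is the identity, where functions on $\Omega$ are extended by $0$ to $\mathbb R$. 2. For all $t\in\mathbb R$, $U_B(t)=R_\pm^*U_0(t)R_\pm$; that is, $R_\pm U_B(t)=U_0(t)R_\pm$, $(V_\pm U_B(t)f)(\lambda)=e(-\lambda t)(V_\pm f)(\lambda)$ for a.e. $\lambda$ and all $f\in L^2(\Omega)$, and $\mathcal F^*\bigl(e(-\lambda t)g\bigr)=U_0(t)\mathcal F^*g$ for all $g\in L^2(\mathbb R)$. -/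

import Mathlib

open MeasureTheory Set Filter Topology

namespace TwoIntervals

noncomputable section

/-- `e(x) = exp(2πix)`. -/
def e (x : ℝ) : ℂ := Complex.exp (2 * Real.pi * Complex.I * x)

/-- The exterior domain `Ω = (-∞,0) ∪ (1,α) ∪ (β,∞)`. -/
def Omega (α β : ℝ) : Set ℝ := Iio 0 ∪ Ioo 1 α ∪ Ioi β

/-- The Hilbert space `L²(Ω)`, with respect to Lebesgue measure on `Ω`. -/
abbrev L2Omega (α β : ℝ) : Type := Lp ℂ 2 (volume.restrict (Omega α β))

/-- The Hilbert space `L²(ℝ)`. -/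
abbrev L2R : Type := Lp ℂ 2 (volume : Measure ℝ)

/-- The unitary matrix with parameters `w, θ, φ, ψ`. -/
def bdryMatrix (w θ φ ψ : ℝ) : Matrix (Fin 2) (Fin 2) ℂ :=
  !![w * e φ, -(Real.sqrt (1 - w ^ 2) * e (θ - ψ));
     Real.sqrt (1 - w ^ 2) * e ψ, w * e (θ - φ)]

/-! ### The momentum operator with boundary condition `B` -/

/-- `F` is absolutely continuous on every compact interval contained in the closure
`(-∞,0] ∪ [1,α] ∪ [β,∞)` of `Ω`. -/
def IsLocACOnClosure (α β : ℝ) (F : ℝ → ℂ) : Prop :=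
  (∀ x ≤ 0, AbsolutelyContinuousOnInterval F x 0) ∧
  AbsolutelyContinuousOnInterval F 1 α ∧
  ∀ x, β ≤ x → AbsolutelyContinuousOnInterval F β x

/-- `(f, g)` is in the graph of `P_B`: both are in `L²(Ω)`, `f` has a representative `F` which is
absolutely continuous up to the boundary of `Ω`, `g = (2πi)⁻¹ F'` almost everywhere on `Ω`, and the
boundary values satisfy `B (F(1), F(β)) = (F(0), F(α))`. -/
def MomentumRel (α β : ℝ) (B : Matrix (Fin 2) (Fin 2) ℂ) (f g : L2Omega α β) : Prop :=
  ∃ F : ℝ → ℂ, IsLocACOnClosure α β F ∧ f =ᵐ[volume.restrict (Omega α β)] F ∧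
    (∀ᵐ x ∂(volume.restrict (Omega α β)), HasDerivAt F (2 * Real.pi * Complex.I * g x) x) ∧
    B.mulVec ![F 1, F β] = ![F 0, F α]

/-- The graph of `P_B`. -/
def momentumGraph (α β : ℝ) (B : Matrix (Fin 2) (Fin 2) ℂ) :
    Submodule ℂ (L2Omega α β × L2Omega α β) where
  carrier := {p | MomentumRel α β B p.1 p.2}
  zero_mem' := by
    have h0 : ∀ a b : ℝ, AbsolutelyContinuousOnInterval (fun _ : ℝ => (0 : ℂ)) a b := by
      intro a b
      simpa [AbsolutelyContinuousOnInterval] using tendsto_const_nhds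
    refine ⟨fun _ => 0, ⟨fun _ _ => h0 _ _, h0 _ _, fun _ _ => h0 _ _⟩,
      Lp.coeFn_zero ℂ 2 _, ?_, ?_⟩
    · filter_upwards [Lp.coeFn_zero ℂ 2 (volume.restrict (Omega α β))] with x hx
      have h : ((0 : L2Omega α β × L2Omega α β).2 : ℝ → ℂ) x = 0 := by simpa using hx
      rw [h, mul_zero]
      exact hasDerivAt_const x 0
    · ext i
      fin_cases i <;> simp [Matrix.mulVec, dotProduct]
  add_mem' := by
    rintro ⟨f, g⟩ ⟨f', g'⟩ ⟨F, hF, hfF, hd, hB⟩ ⟨F', hF', hfF', hd', hB'⟩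
    refine ⟨F + F', ⟨fun x hx => (hF.1 x hx).add (hF'.1 x hx), hF.2.1.add hF'.2.1,
      fun x hx => (hF.2.2 x hx).add (hF'.2.2 x hx)⟩, ?_, ?_, ?_⟩
    · filter_upwards [Lp.coeFn_add f f', hfF, hfF'] with x h h1 h2
      exact h.trans (by simp only [Pi.add_apply]; rw [h1, h2])
    · filter_upwards [Lp.coeFn_add g g', hd, hd'] with x h h1 h2
      have h3 := h1.add h2
      rw [← mul_add] at h3
      have h4 : ((g + g' : L2Omega α β) : ℝ → ℂ) x = g x + g' x := h
      rw [← h4] at h3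
      exact h3
    · have h1 : ![(F + F') 1, (F + F') β] = ![F 1, F β] + ![F' 1, F' β] := by
        simp
      have h2 : ![(F + F') 0, (F + F') α] = ![F 0, F α] + ![F' 0, F' α] := by
        simp
      rw [h1, h2, Matrix.mulVec_add, hB, hB']
  smul_mem' := by
    rintro k ⟨f, g⟩ ⟨F, hF, hfF, hd, hB⟩
    refine ⟨fun x => k • F x, ⟨fun x hx => (hF.1 x hx).const_smul k, hF.2.1.const_smul k,
      fun x hx => (hF.2.2 x hx).const_smul k⟩, ?_, ?_, ?_⟩
    · filter_upwards [Lp.coeFn_smul k f, hfF] with x h h1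
      exact h.trans (by simp only [Pi.smul_apply]; rw [h1])
    · filter_upwards [Lp.coeFn_smul k g, hd] with x h h1
      have h3 := h1.const_smul k
      have h4 : ((k • g : L2Omega α β) : ℝ → ℂ) x = k • g x := h
      rw [← mul_smul_comm, ← h4] at h3
      exact h3
    · have h1 : ![k • F 1, k • F β] = k • ![F 1, F β] := by simp
      have h2 : ![k • F 0, k • F α] = k • ![F 0, F α] := by simp
      rw [h1, h2, Matrix.mulVec_smul, hB]

/-- The operator `P_B`, a restriction of `P = (2πi)⁻¹ d/dx` in `L²(Ω)`. -/
def momentumOp (α β : ℝ) (B : Matrix (Fin 2) (Fin 2) ℂ) : L2Omega α β →ₗ.[ℂ] L2Omega α β :=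
  (momentumGraph α β B).toLinearPMap

theorem isOpen_Omega (α β : ℝ) : IsOpen (Omega α β) :=
  (isOpen_Iio.union isOpen_Ioo).union isOpen_Ioi

theorem IsLocACOnClosure.continuousOn {α β : ℝ} {F : ℝ → ℂ} (hF : IsLocACOnClosure α β F) :
    ContinuousOn F (Omega α β) := by
  have key : ∀ a b x, a < x → x < b → AbsolutelyContinuousOnInterval F a b →
      ContinuousAt F x := by
    intro a b x h1 h2 h
    have h3 := h.continuousOn
    rw [uIcc_of_le (h1.trans h2).le] at h3
    exact h3.continuousAt (Icc_mem_nhds h1 h2)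
  rintro x ((hx | hx) | hx)
  · have hx' : x < 0 := hx
    exact (key (x - 1) 0 x (by linarith) hx (hF.1 _ (by linarith))).continuousWithinAt
  · exact (key 1 α x hx.1 hx.2 hF.2.1).continuousWithinAt
  · have hx' : β < x := hx
    exact (key β (x + 1) x hx (by linarith) (hF.2.2 _ (by linarith))).continuousWithinAt

theorem mem_momentumOp_graph (α β : ℝ) (B : Matrix (Fin 2) (Fin 2) ℂ) (f g : L2Omega α β) :
    (f, g) ∈ (momentumOp α β B).graph ↔ MomentumRel α β B f g := by
  rw [momentumOp, Submodule.toLinearPMap_graph_eq]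
  · rfl
  · rintro ⟨f, g⟩ ⟨F, hF, hfF, hd, -⟩ (h0 : f = 0)
    subst h0
    have hz : F =ᵐ[volume.restrict (Omega α β)] fun _ => (0 : ℂ) :=
      hfF.symm.trans (Lp.coeFn_zero ℂ 2 _)
    have hE : EqOn F (fun _ => (0 : ℂ)) (Omega α β) :=
      Measure.eqOn_open_of_ae_eq hz (isOpen_Omega α β) hF.continuousOn continuousOn_const
    change g = 0
    refine (Lp.eq_zero_iff_ae_eq_zero).2 ?_
    filter_upwards [hd, ae_restrict_mem (isOpen_Omega α β).measurableSet] with x hx hxO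
    have h1 : HasDerivAt F 0 x := (hasDerivAt_const x (0 : ℂ)).congr_of_eventuallyEq
      (hE.eventuallyEq_of_mem ((isOpen_Omega α β).mem_nhds hxO))
    have h2 := hx.unique h1
    simpa [Real.pi_ne_zero, Complex.I_ne_zero] using h2

/-! ### The unitary one-parameter group -/

/-- `U` is the unitary one-parameter group `U(t) = exp(-2πitA)`: a strongly continuous one-parameter
group of unitary operators whose infinitesimal generator is exactly `-2πiA`, domain included. -/
structure IsUnitaryGroupOf {H : Type*} [NormedAddCommGroup H] [InnerProductSpace ℂ H]
    [CompleteSpace H] (A : H →ₗ.[ℂ] H) (U : ℝ → H →L[ℂ] H) : Prop where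
  map_zero : U 0 = ContinuousLinearMap.id ℂ H
  map_add : ∀ s t, U (s + t) = U s ∘L U t
  unitary : ∀ t, U t ∈ unitary (H →L[ℂ] H)
  continuous : ∀ f, Continuous fun t => U t f
  generator : ∀ f g, (f, g) ∈ A.graph ↔
    Tendsto (fun t : ℝ => ((t : ℂ)⁻¹) • (U t f - f)) (𝓝[≠] 0)
      (𝓝 (-(2 * Real.pi * Complex.I) • g))

/-- The group `U_B(t) = exp(-2πitP_B)`. -/
def UB (α β : ℝ) (B : Matrix (Fin 2) (Fin 2) ℂ) : ℝ → L2Omega α β →L[ℂ] L2Omega α β :=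
  Classical.epsilon (IsUnitaryGroupOf (momentumOp α β B))

/-- Right translation by `t` in `L²(ℝ)`. -/
def U0 (t : ℝ) : L2R →L[ℂ] L2R :=
  (Lp.compMeasurePreservingₗᵢ ℂ (fun x : ℝ => x - t)
    (measurePreserving_sub_right volume t)).toContinuousLinearMap

/-! ### Generalized eigenfunctions and translation representations -/

/-- The coefficient `a(l)` on `(-∞,0)`. -/
def coeffA (α w φ ψ l : ℝ) : ℂ :=
  (w : ℂ)⁻¹ * e φ * e l * (1 - Real.sqrt (1 - w ^ 2) * e (-ψ + (α - 1) * l))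

/-- The coefficient `c(l)` on `(β,∞)`. -/
def coeffC (α β w θ φ ψ l : ℝ) : ℂ :=
  (w : ℂ)⁻¹ * e (φ - θ) * e (-(β - α) * l) *
    (1 - Real.sqrt (1 - w ^ 2) * e (ψ - (α - 1) * l))

/-- The generalized eigenfunction
`ψ_l = (a(l) χ_{(-∞,0)} + χ_{(1,α)} + c(l) χ_{(β,∞)}) e(l ·)`. -/
def genEigenfunction (α β w θ φ ψ l x : ℝ) : ℂ :=
  ((Iio (0 : ℝ)).indicator (fun _ => coeffA α w φ ψ l) x + (Ioo 1 α).indicator (fun _ => 1) x +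
    (Ioi β).indicator (fun _ => coeffC α β w θ φ ψ l) x) * e (l * x)

/-- The two signs: `outgoing` is `+`, `incoming` is `-`. -/
inductive Side
  | outgoing
  | incoming

/-- `I_+ = (β,∞)` and `I_- = (-∞,0)`. -/
def sideInterval (β : ℝ) : Side → Set ℝ
  | .outgoing => Ioi β
  | .incoming => Iio 0

/-- The normalized eigenfunctions `ψ_{l,+} = c(l)⁻¹ ψ_l` and `ψ_{l,-} = a(l)⁻¹ ψ_l`. -/
def normEigenfunction (α β w θ φ ψ : ℝ) : Side → ℝ → ℝ → ℂ
  | .outgoing, l, x => (coeffC α β w θ φ ψ l)⁻¹ * genEigenfunction α β w θ φ ψ l x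
  | .incoming, l, x => (coeffA α w φ ψ l)⁻¹ * genEigenfunction α β w θ φ ψ l x

/-- `V` is the transform `(V f)(l) = ∫_Ω conj (Ψ_l(x)) f(x) dx`. As for the Fourier transform, the
integral converges for `f ∈ L¹(Ω) ∩ L²(Ω)`, and `V` is its bounded extension to `L²(Ω)`. -/
def IsTransformOf {α β : ℝ} (Ψ : ℝ → ℝ → ℂ) (V : L2Omega α β →L[ℂ] L2R) : Prop :=
  ∀ f : L2Omega α β, Integrable f (volume.restrict (Omega α β)) →
    V f =ᵐ[volume] fun l => ∫ x in Omega α β, (starRingEnd ℂ) (Ψ l x) * f x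

/-- The operators `V_±`. -/
def V (α β w θ φ ψ : ℝ) (κ : Side) : L2Omega α β →L[ℂ] L2R :=
  Classical.epsilon (IsTransformOf (normEigenfunction α β w θ φ ψ κ))

/-- The inverse `ℱ*` of the unitary Fourier transform `ℱ f(l) = ∫ f(x) e(-lx) dx` of `L²(ℝ)`. -/
def fourierAdj : L2R →L[ℂ] L2R :=
  (Lp.fourierTransformₗᵢ ℝ ℂ).symm.toContinuousLinearEquiv.toContinuousLinearMap

/-- The operators `R_± = ℱ* V_±`. -/
def R (α β w θ φ ψ : ℝ) (κ : Side) : L2Omega α β →L[ℂ] L2R :=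
  fourierAdj ∘L V α β w θ φ ψ κ

/-- The subspaces `D_± = L²(I_±)` of `L²(Ω)`: the functions vanishing a.e. on `Ω` off `I_±`. -/
def D (α β : ℝ) (κ : Side) : Set (L2Omega α β) :=
  {f | ∀ᵐ x ∂(volume.restrict (Omega α β)), x ∉ sideInterval β κ → f x = 0}

end

end TwoIntervals

open TwoIntervals

/-! Everything is built from operators on `L²(ℝ)` that commute with translations. Replacing `e(λ·)`
in `ψ_λ` by a superposition `k` turns multiplication by `a(λ)` and `c(λ)` into two operators `A` =
`opA` and `C` = `opC`, each a combination of two translations. The superposed eigenfunction is `G k`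
= `glue k`, equal to `A k`, `k`, `C k` on the three intervals. The boundary condition then holds at
every translate, not only at the end points: `B` sends `(k(x+1), (C k)(x+β))` to `((A k)(x),
k(x+α))` for almost every `x` (`opA_eq`, `U0_eq`).

Since `B` is unitary, integrating over `ℝ` gives `‖A k‖ = ‖C k‖`, and integrating over `x > 0` gives
`‖G k‖ = ‖A k‖` (`norm_glue`). Because `√(1-w²) < 1`, both `A` and `C` are invertible by a Neumann
series. With `S` = `C` or `A` according to the sign, `T = G S⁻¹` (`transAdj`) is therefore an
isometry. It is onto because `G*` is injective (`glue_adjoint_eq_zero`): the supports of the three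
terms of `G* f` isolate `f` on `I_-`, then on `I_+`, up to a strict contraction. On the Fourier side
`G*` is integration against the conjugate of `ψ_λ`, and `S*` is multiplication by the conjugate of
`c` or `a`. From `S* T* = G*` it follows that `V = ℱ T*` and `R = T*`, and also that `R` is the
identity on `D_±`.

It remains to see that `T U₀(t) T*` is generated by `P_B`. The generator of translations is
described by `IsPrim`: being a primitive, up to a constant, of an `L²` function. If `k` is such a
primitive, then so are `A k` and `C k`, and the relation above at `x = 0` is the boundary condition
for `G k` (`momentumRel_of_isPrim`). Conversely, for `f` in the domain of `P_B` the three terms of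
`G* f` are primitives plus step functions, and the boundary condition cancels the steps
(`isPrim_glue_adjoint`). A unitary group is determined by its generator (`IsUnitaryGroupOf.unique`),
so both signs represent the same `U_B`. -/

namespace TwoIntervals

/-! ### Unitary one-parameter groups and uniqueness from the generator -/

section UnitaryGroup

variable {H : Type*} [NormedAddCommGroup H] [InnerProductSpace ℂ H] [CompleteSpace H]
  {A : H →ₗ.[ℂ] H} {U W : ℝ → H →L[ℂ] H}

theorem IsUnitaryGroupOf.norm_map (hU : IsUnitaryGroupOf A U) (t : ℝ) (f : H) :
    ‖U t f‖ = ‖f‖ :=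
  (ContinuousLinearMap.norm_map_iff_adjoint_comp_self _).2
    (Unitary.star_mul_self_of_mem (hU.unitary t)) f

/-- Orbits of vectors in the domain of the generator are differentiable. -/
theorem IsUnitaryGroupOf.hasDerivAt (hU : IsUnitaryGroupOf A U) {f g : H} (hf : (f, g) ∈ A.graph)
    (t : ℝ) : HasDerivAt (fun t => U t f) (-(2 * Real.pi * Complex.I) • U t g) t := by
  rw [hasDerivAt_iff_tendsto_slope_zero]
  have h := ((U t).continuous.tendsto _).comp ((hU.generator f g).1 hf)
  rw [map_smul] at h
  refine h.congr fun r => ?_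
  simp only [Function.comp_apply, map_smul, map_sub, hU.map_add, ContinuousLinearMap.comp_apply]
  rw [← Complex.ofReal_inv, Complex.coe_smul]

/-- The domain of the generator is invariant under the group. -/
theorem IsUnitaryGroupOf.map_mem_graph (hU : IsUnitaryGroupOf A U) {f g : H}
    (hf : (f, g) ∈ A.graph) (t : ℝ) : (U t f, U t g) ∈ A.graph := by
  rw [hU.generator]
  have h := ((U t).continuous.tendsto _).comp ((hU.generator f g).1 hf)
  rw [map_smul] at h
  refine h.congr fun r => ?_
  have : U r (U t f) = U t (U r f) := by
    rw [← ContinuousLinearMap.comp_apply, ← hU.map_add r t, add_comm, hU.map_add t r]; rfl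
  simp [this]

/-- The generator of a unitary group is skew-symmetric. -/
theorem IsUnitaryGroupOf.re_inner_eq_zero (hU : IsUnitaryGroupOf A U) {f g : H}
    (hf : (f, g) ∈ A.graph) :
    RCLike.re (inner ℂ f (-(2 * Real.pi * Complex.I) • g)) = 0 := by
  have h0 := hU.hasDerivAt hf 0
  have h1 := h0.inner ℂ h0
  have h2 : (fun t => inner ℂ (U t f) (U t f)) = fun _ => inner ℂ f f := by
    funext t
    rw [inner_self_eq_norm_sq_to_K, inner_self_eq_norm_sq_to_K, hU.norm_map]
  rw [h2] at h1
  have h3 := h1.unique (hasDerivAt_const (0 : ℝ) (inner ℂ f f))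
  rw [hU.map_zero] at h3
  simp only [ContinuousLinearMap.id_apply] at h3
  have h4 := congrArg RCLike.re h3
  rw [_root_.map_add, inner_re_symm (𝕜 := ℂ) (-(2 * Real.pi * Complex.I) • g) f] at h4
  simp only [_root_.map_zero] at h4
  linarith

/-- The mean of an orbit is in the domain of the generator. -/
theorem IsUnitaryGroupOf.integral_mem_graph (hU : IsUnitaryGroupOf A U) (f : H) (h : ℝ) :
    ∃ g, (∫ t in (0 : ℝ)..h, U t f, g) ∈ A.graph := by
  refine ⟨(-(2 * Real.pi * Complex.I))⁻¹ • (U h f - f), (hU.generator _ _).2 ?_⟩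
  have hne : (-(2 * Real.pi * Complex.I)) ≠ 0 := by simp [Real.pi_ne_zero]
  rw [smul_inv_smul₀ hne]
  have hc := hU.continuous f
  have hi : ∀ a b, IntervalIntegrable (fun t => U t f) volume a b :=
    fun a b => hc.intervalIntegrable a b
  -- `U r` shifts the window of integration to `[r, h + r]`, so the increment is a difference of two
  -- integrals over windows of length `r`, differentiable in `r` by the fundamental theorem of
  -- calculus.
  have key : ∀ r : ℝ, U r (∫ t in (0 : ℝ)..h, U t f) - ∫ t in (0 : ℝ)..h, U t f =
      (∫ t in (0 : ℝ)..(h + r), U t f) - (∫ t in (0 : ℝ)..h, U t f)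
        - ∫ t in (0 : ℝ)..r, U t f := by
    intro r
    rw [← (U r).intervalIntegral_comp_comm (hi 0 h)]
    have : ∀ t, U r (U t f) = U (t + r) f := fun t => by
      rw [add_comm, hU.map_add]; rfl
    simp_rw [this]
    rw [intervalIntegral.integral_comp_add_right (fun t => U t f) r, zero_add]
    rw [← intervalIntegral.integral_add_adjacent_intervals (hi 0 r) (hi r (h + r))]
    abel
  have h1 : HasDerivAt (fun r : ℝ => (∫ t in (0 : ℝ)..(h + r), U t f) -
      ∫ t in (0 : ℝ)..r, U t f) (U h f - f) 0 := by
    have e1 : HasDerivAt (fun x : ℝ => ∫ t in (0 : ℝ)..x, U t f) (U h f) (h + 0) := by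
      rw [add_zero]; exact (hc.integral_hasStrictDerivAt 0 h).hasDerivAt
    have e2 : HasDerivAt (fun x : ℝ => ∫ t in (0 : ℝ)..x, U t f) f 0 := by
      have := (hc.integral_hasStrictDerivAt 0 0).hasDerivAt
      rwa [hU.map_zero] at this
    exact (e1.comp_const_add h 0).sub e2
  rw [hasDerivAt_iff_tendsto_slope_zero] at h1
  refine h1.congr fun r => ?_
  rw [key, ← Complex.ofReal_inv, Complex.coe_smul]
  simp only [zero_add, add_zero, intervalIntegral.integral_same, sub_zero]
  congr 1
  abel

/-- The domain of the generator of a strongly continuous unitary group is dense. -/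
theorem IsUnitaryGroupOf.dense_domain (hU : IsUnitaryGroupOf A U) :
    Dense {f : H | ∃ g, (f, g) ∈ A.graph} := by
  intro f
  have h1 : HasDerivAt (fun h : ℝ => ∫ t in (0 : ℝ)..h, U t f) f 0 := by
    have := ((hU.continuous f).integral_hasStrictDerivAt 0 0).hasDerivAt
    rwa [hU.map_zero] at this
  rw [hasDerivAt_iff_tendsto_slope_zero] at h1
  refine mem_closure_of_tendsto h1 (Eventually.of_forall fun h => ?_)
  obtain ⟨g, hg⟩ := hU.integral_mem_graph f h
  refine ⟨((h⁻¹ : ℝ) : ℂ) • g, ?_⟩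
  have := A.graph.smul_mem ((h⁻¹ : ℝ) : ℂ) hg
  rw [Prod.smul_mk] at this
  rw [zero_add, intervalIntegral.integral_same, sub_zero, ← Complex.coe_smul]
  exact this

/-- A unitary one-parameter group is determined by its generator. -/
theorem IsUnitaryGroupOf.unique (hU : IsUnitaryGroupOf A U) (hW : IsUnitaryGroupOf A W) :
    U = W := by
  have key : ∀ f g, (f, g) ∈ A.graph → ∀ t, U t f = W t f := by
    intro f g hf t
    have hd : ∀ s, HasDerivAt (fun s => inner ℂ (U s f - W s f) (U s f - W s f)) 0 s := by
      intro s
      have h0 := (hU.hasDerivAt hf s).sub (hW.hasDerivAt hf s)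
      have hm : (U s f - W s f, U s g - W s g) ∈ A.graph :=
        A.graph.sub_mem (hU.map_mem_graph hf s) (hW.map_mem_graph hf s)
      have h1 := hU.re_inner_eq_zero hm
      rw [← smul_sub] at h0
      have h2 := h0.inner ℂ h0
      convert! h2 using 1
      -- The derivative of the squared norm is `z + conj z = 2 Re z`, and `Re z = 0` by
      -- skew-symmetry applied to the difference, which is again in the graph.
      rw [← inner_conj_symm (-(2 * Real.pi * Complex.I) • (U s g - W s g)), RCLike.add_conj]
      simp only [Pi.sub_apply, h1]
      simp
    have h3 := is_const_of_deriv_eq_zero (fun s => (hd s).differentiableAt)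
      (fun s => (hd s).deriv) t 0
    rw [hU.map_zero, hW.map_zero, sub_self, inner_zero_left] at h3
    exact sub_eq_zero.1 (inner_self_eq_zero.1 h3)
  funext t
  refine ContinuousLinearMap.ext fun f => ?_
  have := hU.dense_domain.closure_eq ▸ mem_univ f
  refine closure_minimal (s := {f | ∃ g, (f, g) ∈ A.graph}) (t := {f | U t f = W t f})
    (fun f ⟨g, hg⟩ => key f g hg t) (isClosed_eq (U t).continuous (W t).continuous) this

end UnitaryGroup

end TwoIntervals

namespace TwoIntervals

noncomputable section

/-! ### Translations -/

theorem U0_apply_ae (t : ℝ) (u : L2R) : U0 t u =ᵐ[volume] fun x => u (x - t) :=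
  Lp.coeFn_compMeasurePreserving u (measurePreserving_sub_right volume t)

theorem norm_U0 (t : ℝ) (u : L2R) : ‖U0 t u‖ = ‖u‖ :=
  (Lp.compMeasurePreservingₗᵢ ℂ (fun x : ℝ => x - t) _).norm_map u

/-- Almost everywhere statements may be translated. -/
theorem ae_sub {p : ℝ → Prop} (t : ℝ) (h : ∀ᵐ x, p x) : ∀ᵐ x : ℝ, p (x - t) :=
  (measurePreserving_sub_right volume t).quasiMeasurePreserving.ae h

theorem U0_U0 (s t : ℝ) (u : L2R) : U0 s (U0 t u) = U0 (s + t) u := by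
  refine Lp.ext ?_
  filter_upwards [U0_apply_ae s (U0 t u), U0_apply_ae (s + t) u, ae_sub s (U0_apply_ae t u)]
    with x h1 h2 h3
  rw [h1, h2, h3]
  congr 1
  ring

theorem U0_zero (u : L2R) : U0 0 u = u := by
  refine Lp.ext ?_
  filter_upwards [U0_apply_ae 0 u] with x h1
  rw [h1, sub_zero]

theorem continuous_U0 (u : L2R) : Continuous fun t => U0 t u := by
  let g : ℝ → C(ℝ, ℝ) := fun t => ⟨fun x => x - t, by fun_prop⟩
  have hg : Continuous g := ContinuousMap.continuous_of_continuous_uncurry _ (by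
    change Continuous fun p : ℝ × ℝ => p.2 - p.1
    fun_prop)
  exact Continuous.compMeasurePreservingLp (p := 2) (μ := volume) (ν := volume)
    (f := fun _ : ℝ => u) (g := g) continuous_const hg
    (fun t => measurePreserving_sub_right volume t) (by simp)

/-- Translations are isometries, and `U0 (-t)` inverts `U0 t`. -/
theorem U0_adjoint (t : ℝ) : (U0 t).adjoint = U0 (-t) := by
  refine ((ContinuousLinearMap.eq_adjoint_iff _ _).2 fun u v => ?_).symm
  have h : v = U0 (-t) (U0 t v) := by rw [U0_U0, neg_add_cancel, U0_zero]
  conv_lhs => rw [h]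
  let J : L2R →ₗᵢ[ℂ] L2R := Lp.compMeasurePreservingₗᵢ ℂ (fun x : ℝ => x - (-t))
    (measurePreserving_sub_right volume (-t))
  exact J.inner_map_map u (U0 t v)

/-! ### Extension by zero and multiplication by indicator functions -/

section ZeroExt

variable {s : Set ℝ}

theorem memLp_zeroExt (hs : MeasurableSet s) (f : Lp ℂ 2 (volume.restrict s)) : MemLp (s.indicator f) 2 volume :=
  (memLp_indicator_iff_restrict hs).2 (Lp.memLp f)

/-- Extension by zero. -/
def zeroExt (hs : MeasurableSet s) : Lp ℂ 2 (volume.restrict s) →ₗᵢ[ℂ] L2R where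
  toFun f := (memLp_zeroExt hs f).toLp _
  map_add' f g := by
    rw [← MemLp.toLp_add]
    refine MemLp.toLp_congr _ _ ?_
    filter_upwards [(ae_restrict_iff' hs).1 (Lp.coeFn_add f g)] with x hx
    by_cases h : x ∈ s
    · simpa only [Pi.add_apply, indicator_of_mem h] using hx h
    · simp [h]
  map_smul' c f := by
    rw [RingHom.id_apply, ← MemLp.toLp_const_smul]
    refine MemLp.toLp_congr _ _ ?_
    filter_upwards [(ae_restrict_iff' hs).1 (Lp.coeFn_smul c f)] with x hx
    by_cases h : x ∈ s
    · simp [h, hx h]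
    · simp [h]
  norm_map' f := by
    change ‖(memLp_zeroExt hs f).toLp _‖ = _
    rw [Lp.norm_toLp, Lp.norm_def, eLpNorm_indicator_eq_eLpNorm_restrict hs]

theorem zeroExt_ae (hs : MeasurableSet s) (f : Lp ℂ 2 (volume.restrict s)) :
    zeroExt hs f =ᵐ[volume] s.indicator f :=
  MemLp.coeFn_toLp (memLp_zeroExt hs f)

/-- Restriction to `s`. -/
def restr (s : Set ℝ) : L2R →L[ℂ] Lp ℂ 2 (volume.restrict s) :=
  LpToLpRestrictCLM ℝ ℂ ℂ volume 2 s

theorem restr_ae (s : Set ℝ) (u : L2R) : restr s u =ᵐ[volume.restrict s] u :=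
  LpToLpRestrictCLM_coeFn ℂ s u

theorem restr_zeroExt (hs : MeasurableSet s) (f : Lp ℂ 2 (volume.restrict s)) : restr s (zeroExt hs f) = f := by
  refine Lp.ext ?_
  filter_upwards [restr_ae s (zeroExt hs f), ae_restrict_of_ae (zeroExt_ae hs f),
    ae_restrict_mem hs] with x h1 h2 h3
  rw [h1, h2, indicator_of_mem h3]

theorem restr_adjoint (hs : MeasurableSet s) : (restr s).adjoint = (zeroExt hs).toContinuousLinearMap := by
  refine ((ContinuousLinearMap.eq_adjoint_iff _ _).2 fun f u => ?_).symm
  rw [L2.inner_def, L2.inner_def, ← integral_indicator hs]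
  refine integral_congr_ae ?_
  filter_upwards [zeroExt_ae hs f, (ae_restrict_iff' hs).1 (restr_ae s u)] with x h1 h2
  by_cases h : x ∈ s
  · simp [h1, h, h2 h]
  · simp [h1, h]

/-- Multiplication by the indicator function of `s`. -/
def cut (hs : MeasurableSet s) : L2R →L[ℂ] L2R := (zeroExt hs).toContinuousLinearMap ∘L restr s

theorem cut_ae (hs : MeasurableSet s) (u : L2R) : cut hs u =ᵐ[volume] s.indicator u := by
  filter_upwards [zeroExt_ae hs (restr s u), (ae_restrict_iff' hs).1 (restr_ae s u)] with x h1 h2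
  change zeroExt hs (restr s u) x = _
  by_cases h : x ∈ s
  · rw [h1, indicator_of_mem h, indicator_of_mem h, h2 h]
  · rw [h1, indicator_of_notMem h, indicator_of_notMem h]

theorem cut_adjoint (hs : MeasurableSet s) : (cut hs).adjoint = cut hs := by
  rw [cut, ContinuousLinearMap.adjoint_comp, restr_adjoint hs, ← restr_adjoint hs,
    ContinuousLinearMap.adjoint_adjoint]

theorem cut_cut (hs : MeasurableSet s) {t : Set ℝ} (ht : MeasurableSet t) (u : L2R) :
    cut hs (cut ht u) = cut (hs.inter ht) u := by
  refine Lp.ext ?_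
  filter_upwards [cut_ae hs (cut ht u), cut_ae ht u, cut_ae (hs.inter ht) u] with x h1 h2 h3
  rw [h1, h3, ← indicator_indicator]
  simp only [indicator, h2]

theorem cut_of_eq_empty (hs : MeasurableSet s) (h : s = ∅) (u : L2R) : cut hs u = 0 := by
  refine Lp.ext ?_
  filter_upwards [cut_ae hs u, Lp.coeFn_zero ℂ 2 volume] with x h1 h2
  rw [h1, h2, h]
  simp

theorem cut_congr (hs : MeasurableSet s) {t : Set ℝ} {ht : MeasurableSet t} (h : s = t) (u : L2R) :
    cut hs u = cut ht u := by subst h; rfl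

theorem cut_cut_of_subset (hs : MeasurableSet s) {t : Set ℝ} (ht : MeasurableSet t) (h : t ⊆ s) (u : L2R) :
    cut hs (cut ht u) = cut ht u := by
  rw [cut_cut]
  exact cut_congr _ (inter_eq_right.2 h) u

theorem cut_cut_of_disjoint (hs : MeasurableSet s) {t : Set ℝ} (ht : MeasurableSet t) (h : Disjoint s t) (u : L2R) :
    cut hs (cut ht u) = 0 := by
  rw [cut_cut]
  exact cut_of_eq_empty _ h.inter_eq u

theorem cut_U0 (hs : MeasurableSet s) {t : Set ℝ} (ht : MeasurableSet t) (r : ℝ) (h : ∀ x, x ∈ s ↔ x - r ∈ t) (u : L2R) :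
    cut hs (U0 r u) = U0 r (cut ht u) := by
  refine Lp.ext ?_
  filter_upwards [cut_ae hs (U0 r u), U0_apply_ae r u, U0_apply_ae r (cut ht u),
    ae_sub r (cut_ae ht u)] with x h1 h2 h3 h4
  rw [h1, h3, h4]
  by_cases hx : x ∈ s
  · rw [indicator_of_mem hx, indicator_of_mem ((h x).1 hx), h2]
  · rw [indicator_of_notMem hx, indicator_of_notMem (mt (h x).2 hx)]

theorem cut_Ioi_U0 (a r : ℝ) (u : L2R) :
    cut (measurableSet_Ioi (a := a)) (U0 r u) = U0 r (cut (measurableSet_Ioi (a := a - r)) u) :=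
  cut_U0 _ _ r (fun x => by simp) u

theorem cut_Iio_U0 (a r : ℝ) (u : L2R) :
    cut (measurableSet_Iio (a := a)) (U0 r u) = U0 r (cut (measurableSet_Iio (a := a - r)) u) :=
  cut_U0 _ _ r (fun x => by simp) u

theorem norm_sq_eq_integral {μ : Measure ℝ} (u : Lp ℂ 2 μ) : ‖u‖ ^ 2 = ∫ x, ‖u x‖ ^ 2 ∂μ := by
  rw [← @inner_self_eq_norm_sq ℂ, L2.inner_def, ← integral_re (L2.integrable_inner u u)]
  refine integral_congr_ae (Eventually.of_forall fun x => ?_)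
  exact inner_self_eq_norm_sq (𝕜 := ℂ) (u x)

theorem integrable_norm_sq {μ : Measure ℝ} (u : Lp ℂ 2 μ) : Integrable (fun x => ‖u x‖ ^ 2) μ :=
  (memLp_two_iff_integrable_sq_norm (Lp.aestronglyMeasurable u)).1 (Lp.memLp u)

theorem norm_cut_sq (hs : MeasurableSet s) (u : L2R) : ‖cut hs u‖ ^ 2 = ∫ x in s, ‖u x‖ ^ 2 := by
  rw [norm_sq_eq_integral, ← integral_indicator hs]
  refine integral_congr_ae ?_
  filter_upwards [cut_ae hs u] with x h1
  by_cases h : x ∈ s <;> simp [h1, h]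

theorem norm_cut_le (hs : MeasurableSet s) (u : L2R) : ‖cut hs u‖ ≤ ‖u‖ := by
  rw [← sq_le_sq₀ (norm_nonneg _) (norm_nonneg _), norm_cut_sq, norm_sq_eq_integral]
  exact setIntegral_le_integral (integrable_norm_sq u) (Eventually.of_forall fun x => by positivity)

end ZeroExt

theorem norm_sq_eq_cut_add (a : ℝ) (u : L2R) :
    ‖u‖ ^ 2 = ‖cut (measurableSet_Iio (a := a)) u‖ ^ 2 +
      ‖cut (measurableSet_Ioi (a := a)) u‖ ^ 2 := by
  have hi := integrable_norm_sq u
  rw [norm_cut_sq, norm_cut_sq, norm_sq_eq_integral, ← integral_Ici_eq_integral_Ioi,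
    ← compl_Iio, integral_add_compl measurableSet_Iio hi]

theorem norm_cut_Ioi_sq {a b : ℝ} (hab : a < b) (u : L2R) :
    ‖cut (measurableSet_Ioi (a := a)) u‖ ^ 2 =
      ‖cut (measurableSet_Ioo (a := a) (b := b)) u‖ ^ 2 +
      ‖cut (measurableSet_Ioi (a := b)) u‖ ^ 2 := by
  have hi := integrable_norm_sq u
  rw [norm_cut_sq, norm_cut_sq, norm_cut_sq, ← integral_Ici_eq_integral_Ioi (x := b),
    ← Ioo_union_Ici_eq_Ioi hab, setIntegral_union _ measurableSet_Ici hi.integrableOn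
      hi.integrableOn]
  exact Set.disjoint_left.2 fun x h1 h2 => not_le.2 h1.2 h2

end

end TwoIntervals

namespace TwoIntervals

noncomputable section

/-! ### Functions in `L²(ℝ)` with a derivative in `L²(ℝ)` -/

/-- The primitive of `r` vanishing at `0`. -/
def prim (r : ℝ → ℂ) (x : ℝ) : ℂ := ∫ y in (0 : ℝ)..x, r y

/-- `p` is almost everywhere the sum of `σ` and of a primitive of `r`. -/
def IsPrim (p r : L2R) (σ : ℝ → ℂ) : Prop := p =ᵐ[volume] fun x => σ x + prim r x

theorem locallyIntegrable_L2 (r : L2R) : LocallyIntegrable r volume :=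
  (Lp.memLp r).locallyIntegrable (by norm_num)

theorem intervalIntegrable_L2 (r : L2R) (a b : ℝ) : IntervalIntegrable r volume a b :=
  intervalIntegrable_iff.2 (((locallyIntegrable_L2 r).integrableOn_isCompact isCompact_uIcc).mono_set
    uIoc_subset_uIcc)

theorem prim_sub_prim (r : L2R) (a b : ℝ) : prim r b - prim r a = ∫ y in a..b, r y :=
  intervalIntegral.integral_interval_sub_left (intervalIntegrable_L2 r _ _)
    (intervalIntegrable_L2 r _ _)

theorem continuous_prim (r : L2R) : Continuous (prim r) :=
  intervalIntegral.continuous_primitive (fun a b => intervalIntegrable_L2 r a b) 0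

theorem ae_hasDerivAt_prim (r : L2R) : ∀ᵐ x, HasDerivAt (prim r) (r x) x := by
  filter_upwards [LocallyIntegrable.ae_hasDerivAt_integral (locallyIntegrable_L2 r)] with x hx
  exact hx 0

theorem prim_congr {r r' : ℝ → ℂ} (h : r =ᵐ[volume] r') : prim r = prim r' := by
  funext x
  refine intervalIntegral.integral_congr_ae ?_
  filter_upwards [h] with x hx _ using hx

/-- Elements of `L²(ℝ)` with equal integrals over intervals are equal. -/
theorem eq_of_integral_eq {u v : L2R}
    (h : ∀ a b, a ≤ b → ∫ x in a..b, u x = ∫ x in a..b, v x) : u = v := by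
  have hp : prim u = prim v := by
    funext x
    rcases le_total 0 x with hx | hx
    · exact h 0 x hx
    · change ∫ _ in _.._, _ = ∫ _ in _.._, _
      rw [intervalIntegral.integral_symm, h x 0 hx, ← intervalIntegral.integral_symm]
  refine Lp.ext ?_
  filter_upwards [ae_hasDerivAt_prim u, ae_hasDerivAt_prim v] with x h1 h2
  rw [hp] at h1
  exact h1.unique h2

/-- Integration over an interval, as a continuous linear functional. -/
def intervalFunctional (a b : ℝ) : L2R →L[ℂ] ℂ :=
  innerSL ℂ (indicatorConstLp 2 (measurableSet_Ioc (a := a) (b := b)) (by simp) (1 : ℂ))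

theorem intervalFunctional_apply {a b : ℝ} (hab : a ≤ b) (u : L2R) :
    intervalFunctional a b u = ∫ x in a..b, u x := by
  rw [intervalIntegral.integral_of_le hab]
  exact L2.inner_indicatorConstLp_one measurableSet_Ioc (by simp) u

theorem integral_U0 (u : L2R) (t a b : ℝ) :
    ∫ x in a..b, U0 t u x = ∫ x in (a - t)..(b - t), u x := by
  rw [← intervalIntegral.integral_comp_sub_right (fun x => u x) t]
  refine intervalIntegral.integral_congr_ae ?_
  filter_upwards [U0_apply_ae t u] with x hx _ using hx

theorem integral_U0_eq_prim (u : L2R) (t a b : ℝ) :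
    ∫ x in a..b, U0 t u x = prim u (b - t) - prim u (a - t) := by
  rw [integral_U0, prim_sub_prim]

/-- Integrating over an interval `[a, b]` reduces the vector identity to a scalar one: the integral
of `p(x - t)` over `[a, b]` has `t`-derivative `p(a - t) - p(b - t)`, for the continuous
representative of `p`, and this is minus the integral of `r(x - t)`. -/
theorem IsPrim.integral_eq {p r : L2R} {c : ℂ} (h : IsPrim p r fun _ => c) (t : ℝ) :
    U0 t p - p = -∫ τ in (0 : ℝ)..t, U0 τ r := by
  have hP : Continuous fun x => c + prim r x := continuous_const.add (continuous_prim r)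
  have hint : ∀ a b, ∫ x in a..b, p x = ∫ x in a..b, (c + prim r x) := fun a b =>
    intervalIntegral.integral_congr_ae (by filter_upwards [h] with x hx _ using hx)
  have hd : ∀ x, HasDerivAt (prim p) (c + prim r x) x := by
    intro x
    have h1 : prim p = fun x => ∫ y in (0 : ℝ)..x, (c + prim r y) := funext fun x => hint 0 x
    rw [h1]
    exact (hP.integral_hasStrictDerivAt 0 x).hasDerivAt
  refine eq_of_integral_eq fun a b hab => ?_
  rw [← intervalFunctional_apply hab, ← intervalFunctional_apply hab, map_sub, map_neg,
    ← (intervalFunctional a b).intervalIntegral_comp_comm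
      ((continuous_U0 r).intervalIntegrable _ _)]
  have h1 : ∀ t, HasDerivAt (fun t => intervalFunctional a b (U0 t p))
      (-(intervalFunctional a b (U0 t r))) t := by
    intro t
    simp only [intervalFunctional_apply hab, integral_U0_eq_prim]
    have := ((hd (b - t)).comp_const_sub b t).sub ((hd (a - t)).comp_const_sub a t)
    convert! this using 1
    ring
  have h2 := intervalIntegral.integral_eq_sub_of_hasDerivAt (a := 0) (b := t) (fun t _ => h1 t)
    (Continuous.intervalIntegrable (by
      exact ((intervalFunctional a b).continuous.comp (continuous_U0 r)).neg) _ _)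
  rw [intervalIntegral.integral_neg, U0_zero] at h2
  exact h2.symm

/-- The generator of the translation group, on functions given as primitives. -/
theorem IsPrim.tendsto {p r : L2R} {c : ℂ} (h : IsPrim p r fun _ => c) :
    Tendsto (fun t : ℝ => ((t : ℂ)⁻¹) • (U0 t p - p)) (𝓝[≠] 0) (𝓝 (-r)) := by
  have h1 := ((continuous_U0 r).integral_hasStrictDerivAt 0 0).hasDerivAt.neg
  rw [hasDerivAt_iff_tendsto_slope_zero, U0_zero] at h1
  refine h1.congr fun t => ?_
  rw [h.integral_eq, ← Complex.ofReal_inv, Complex.coe_smul]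
  simp only [Pi.neg_apply, zero_add, intervalIntegral.integral_same, neg_zero, sub_zero]
  rfl

/-- The domain of the generator of the translation group consists of primitives. -/
theorem IsPrim.of_tendsto {p r : L2R}
    (h : Tendsto (fun t : ℝ => ((t : ℂ)⁻¹) • (U0 t p - p)) (𝓝[≠] 0) (𝓝 (-r))) :
    ∃ c : ℂ, IsPrim p r fun _ => c := by
  -- Testing the `L²` limit against the indicator of `(a, b]` gives a relation between values of `p`
  -- at Lebesgue-type points. Almost every point qualifies, so one of them can serve as base point
  -- and fix the constant.
  have key : ∀ a b, a ≤ b → HasDerivAt (prim p) (p a) a → HasDerivAt (prim p) (p b) b →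
      p b - p a = ∫ x in a..b, r x := by
    intro a b hab ha hb
    have h1 := ((intervalFunctional a b).continuous.tendsto _).comp h
    have h2 : HasDerivAt (fun t => prim p (b - t) - prim p (a - t)) (-p b - -p a) 0 := by
      refine HasDerivAt.sub ?_ ?_
      · exact HasDerivAt.comp_const_sub b 0 (by rwa [sub_zero])
      · exact HasDerivAt.comp_const_sub a 0 (by rwa [sub_zero])
    rw [hasDerivAt_iff_tendsto_slope_zero] at h2
    have h3 := tendsto_nhds_unique h1 (h2.congr fun t => by
      rw [Function.comp_apply, map_smul, map_sub, intervalFunctional_apply hab,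
        intervalFunctional_apply hab, integral_U0_eq_prim]
      rw [← Complex.ofReal_inv, ← Complex.coe_smul, zero_add, sub_zero, sub_zero,
        prim_sub_prim p a b])
    rw [map_neg, intervalFunctional_apply hab] at h3
    linear_combination h3
  obtain ⟨a, ha⟩ := (ae_hasDerivAt_prim p).exists
  refine ⟨p a - prim r a, ?_⟩
  filter_upwards [ae_hasDerivAt_prim p] with b hb
  rcases le_total a b with hab | hab
  · have := key a b hab ha hb
    rw [← prim_sub_prim] at this
    linear_combination this
  · have := key b a hab hb ha
    rw [← prim_sub_prim] at this
    linear_combination -this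

theorem IsPrim.add {p r p' r' : L2R} {σ σ' : ℝ → ℂ} (h : IsPrim p r σ) (h' : IsPrim p' r' σ') :
    IsPrim (p + p') (r + r') fun x => σ x + σ' x := by
  have h1 : prim (r + r' : L2R) = prim r + prim r' := by
    rw [prim_congr (Lp.coeFn_add r r')]
    funext x
    exact intervalIntegral.integral_add (intervalIntegrable_L2 r _ _)
      (intervalIntegrable_L2 r' _ _)
  filter_upwards [h, h', Lp.coeFn_add p p'] with x h2 h3 h4
  rw [h4, h1, Pi.add_apply, Pi.add_apply, h2, h3]
  ring

theorem IsPrim.smul {p r : L2R} {σ : ℝ → ℂ} (z : ℂ) (h : IsPrim p r σ) :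
    IsPrim (z • p) (z • r) fun x => z * σ x := by
  have h1 : prim (z • r : L2R) = z • prim r := by
    rw [prim_congr (Lp.coeFn_smul z r)]
    funext x
    exact intervalIntegral.integral_smul z _
  filter_upwards [h, Lp.coeFn_smul z p] with x h2 h4
  rw [h4, h1, Pi.smul_apply, Pi.smul_apply, h2, smul_eq_mul, smul_eq_mul]
  ring

theorem IsPrim.sub {p r p' r' : L2R} {σ σ' : ℝ → ℂ} (h : IsPrim p r σ) (h' : IsPrim p' r' σ') :
    IsPrim (p - p') (r - r') fun x => σ x - σ' x := by
  have := h.add (h'.smul (-1))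
  simpa [sub_eq_add_neg] using this

/-- The constant `prim r (-t)` appears because `prim` is normalized to vanish at `0`, which
translation does not respect. -/
theorem IsPrim.translate {p r : L2R} {σ : ℝ → ℂ} (t : ℝ) (h : IsPrim p r σ) :
    IsPrim (U0 t p) (U0 t r) fun x => σ (x - t) + prim r (-t) := by
  filter_upwards [U0_apply_ae t p, ae_sub t h] with x h1 h2
  have := integral_U0_eq_prim r t 0 x
  rw [zero_sub] at this
  rw [h1, h2]
  change _ = _ + ∫ y in (0 : ℝ)..x, _
  rw [this]
  ring

/-- Equal elements have equal primitives. -/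
theorem IsPrim.eq_of_continuous {p r p' r' : L2R} {σ σ' : ℝ → ℂ} (h : IsPrim p r σ)
    (h' : IsPrim p' r' σ') (hp : p = p') (hσ : Continuous σ) (hσ' : Continuous σ') (x : ℝ) :
    σ x + prim r x = σ' x + prim r' x := by
  subst hp
  exact congrFun (((hσ.add (continuous_prim r)).ae_eq_iff_eq volume
    (hσ'.add (continuous_prim r'))).1 (h.symm.trans h')) x

/-! ### Absolute continuity -/

/-- Increments of `prim r` are dominated by those of the primitive of `‖r‖`. -/
theorem absolutelyContinuous_prim (r : L2R) (a b : ℝ) :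
    AbsolutelyContinuousOnInterval (prim r) a b := by
  have hi : ∀ x y, IntervalIntegrable (fun v => ‖r v‖) volume x y :=
    fun x y => (intervalIntegrable_L2 r x y).norm
  have h := (hi a b).absolutelyContinuousOnInterval_intervalIntegral (c := a) left_mem_uIcc
  refine squeeze_zero (fun E => Finset.sum_nonneg fun i _ => dist_nonneg)
    (fun E => Finset.sum_le_sum fun i _ => ?_) h
  rw [dist_comm, dist_comm _ (∫ v in a..(E.2 i).2, ‖r v‖), dist_eq_norm, prim_sub_prim,
    dist_eq_norm, intervalIntegral.integral_interval_sub_left (hi _ _) (hi _ _)]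
  exact intervalIntegral.norm_integral_le_abs_integral_norm

theorem absolutelyContinuous_congr {F G : ℝ → ℂ} {a b : ℝ}
    (h : AbsolutelyContinuousOnInterval F a b) (hFG : EqOn F G (uIcc a b)) :
    AbsolutelyContinuousOnInterval G a b := by
  refine Tendsto.congr' ?_ h
  filter_upwards [mem_inf_of_right (mem_principal_self _)] with E hE
  refine Finset.sum_congr rfl fun i hi => ?_
  rw [hFG (hE.1 i hi).1, hFG (hE.1 i hi).2]

theorem absolutelyContinuous_const (c : ℂ) (a b : ℝ) :
    AbsolutelyContinuousOnInterval (fun _ : ℝ => c) a b := by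
  simpa [AbsolutelyContinuousOnInterval] using tendsto_const_nhds

/-- An absolutely continuous function is a primitive of its derivative. -/
theorem eq_add_prim {F : ℝ → ℂ} {r : L2R} {a b : ℝ} (hab : a ≤ b)
    (hF : AbsolutelyContinuousOnInterval F a b)
    (hd : ∀ᵐ x, x ∈ Ioo a b → HasDerivAt F (r x) x) :
    ∀ x ∈ Icc a b, ∀ y ∈ Icc a b, F y - F x = prim r y - prim r x := by
  have h := hF.sub (absolutelyContinuous_prim r a b)
  obtain ⟨C, hC⟩ := h.const_of_ae_hasDerivAt_zero (by
    filter_upwards [hd, ae_hasDerivAt_prim r, Measure.ae_ne volume a, Measure.ae_ne volume b]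
      with x h1 h2 h3 h4 hx
    rw [uIcc_of_le hab] at hx
    have := (h1 ⟨lt_of_le_of_ne hx.1 h3.symm, lt_of_le_of_ne hx.2 h4⟩).sub h2
    rwa [sub_self] at this)
  rw [uIcc_of_le hab] at hC
  intro x hx y hy
  have h1 := hC x hx
  have h2 := hC y hy
  simp only [Pi.sub_apply] at h1 h2
  linear_combination h2 - h1

end

end TwoIntervals

namespace TwoIntervals

noncomputable section

/-! ### The Fourier transform of `L²(ℝ)` -/

theorem e_add (x y : ℝ) : e (x + y) = e x * e y := by
  rw [e, e, e, ← Complex.exp_add]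
  congr 1
  push_cast
  ring

theorem e_zero : e 0 = 1 := by simp [e]

theorem e_ne_zero (x : ℝ) : e x ≠ 0 := Complex.exp_ne_zero _

theorem e_neg (x : ℝ) : e (-x) = (e x)⁻¹ := by
  refine eq_inv_of_mul_eq_one_left ?_
  rw [← e_add, neg_add_cancel, e_zero]

theorem norm_e (x : ℝ) : ‖e x‖ = 1 := by
  rw [e, Complex.norm_exp]
  simp

theorem conj_e (x : ℝ) : (starRingEnd ℂ) (e x) = e (-x) := by
  rw [e_neg, Complex.inv_def, Complex.normSq_eq_norm_sq, norm_e]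
  simp

theorem continuous_e : Continuous e := by unfold e; fun_prop

/-- The unitary Fourier transform of `L²(ℝ)`. -/
def fourierL2 : L2R ≃ₗᵢ[ℂ] L2R := Lp.fourierTransformₗᵢ ℝ ℂ

open FourierTransform SchwartzMap in
/-- On integrable functions, the Fourier transform is given by the integral. -/
theorem fourierL2_ae_of_integrable (f : L2R) (hf : Integrable f volume) :
    fourierL2 f =ᵐ[volume] fun l => ∫ x, e (-(l * x)) * f x := by
  have h1 : (fun l => ∫ x, e (-(l * x)) * f x) = 𝓕 (f : ℝ → ℂ) := by
    funext l
    rw [Real.fourier_real_eq_integral_exp_smul]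
    refine integral_congr_ae (Eventually.of_forall fun x => ?_)
    simp only [e, smul_eq_mul]
    congr 2
    push_cast
    ring
  rw [h1]
  have hc : Continuous (𝓕 (f : ℝ → ℂ)) := by
    exact VectorFourier.fourierIntegral_continuous Real.continuous_fourierChar
      (by exact continuous_inner) hf
  -- Both transforms are compared as distributions. Against a test function `g`, each gives the
  -- integral of `𝓕 g` times `f`: one by compatibility of the `L²` transform with tempered
  -- distributions, the other by Fubini.
  refine ae_eq_of_integral_contDiff_smul_eq (locallyIntegrable_L2 _) hc.locallyIntegrable
    fun g hg hgc => ?_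
  have hg1 : HasCompactSupport (Complex.ofRealCLM ∘ g) := hgc.comp_left rfl
  have hg2 : ContDiff ℝ (⊤ : ℕ∞) (Complex.ofRealCLM ∘ g) := Complex.ofRealCLM.contDiff.comp hg
  let G : 𝓢(ℝ, ℂ) := hg1.toSchwartzMap hg2
  have h2 := congrArg (fun T => T G) (Lp.fourier_toTemperedDistribution_eq f)
  simp only [TemperedDistribution.fourier_apply, Lp.toTemperedDistribution_apply] at h2
  have h3 := VectorFourier.integral_fourierIntegral_smul_eq_flip (L := innerₗ ℝ)
    Real.continuous_fourierChar continuous_inner (G.integrable (μ := volume)) hf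
  have h4 : ∫ x, g x • 𝓕 (f : ℝ → ℂ) x = ∫ x, (𝓕 G) x • f x := by
    rw [flip_innerₗ] at h3
    exact h3.symm
  rw [h4, h2]
  rfl

/-- The Fourier transform intertwines translations and multiplications by characters. -/
theorem fourierL2_U0_of_integrable (t : ℝ) (f : L2R) (hf : Integrable f volume) :
    fourierL2 (U0 t f) =ᵐ[volume] fun l => e (-l * t) * fourierL2 f l := by
  have hi : Integrable (U0 t f) volume :=
    (hf.comp_sub_right t).congr (U0_apply_ae t f).symm
  filter_upwards [fourierL2_ae_of_integrable f hf, fourierL2_ae_of_integrable _ hi] with l h1 h2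
  rw [h1, h2, ← integral_const_mul, ← integral_sub_right_eq_self (fun x => e (-l * t) * (e (-(l * x)) * f x)) t]
  refine integral_congr_ae ?_
  filter_upwards [U0_apply_ae t f] with x hx
  rw [hx, ← mul_assoc, ← e_add]
  congr 2
  ring

theorem memLp_e_mul (t : ℝ) {g : ℝ → ℂ} (hg : MemLp g 2 volume) :
    MemLp (fun l => e (-l * t) * g l) 2 volume := by
  refine hg.congr_norm ((Continuous.aestronglyMeasurable (by
    have := continuous_e; fun_prop)).mul hg.1) (Eventually.of_forall fun l => ?_)
  rw [norm_mul, norm_e, one_mul]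

/-- Multiplication by `e(-lt)` on `L²(ℝ)`. -/
def modulation (t : ℝ) : L2R →ₗᵢ[ℂ] L2R where
  toFun g := (memLp_e_mul t (Lp.memLp g)).toLp _
  map_add' f g := by
    rw [← MemLp.toLp_add]
    refine MemLp.toLp_congr _ _ ?_
    filter_upwards [Lp.coeFn_add f g] with x hx
    rw [hx, Pi.add_apply, Pi.add_apply, mul_add]
  map_smul' c f := by
    rw [RingHom.id_apply, ← MemLp.toLp_const_smul]
    refine MemLp.toLp_congr _ _ ?_
    filter_upwards [Lp.coeFn_smul c f] with x hx
    rw [hx, Pi.smul_apply, Pi.smul_apply, mul_smul_comm]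
  norm_map' f := by
    change ‖(memLp_e_mul t (Lp.memLp f)).toLp _‖ = _
    rw [Lp.norm_toLp, Lp.norm_def]
    congr 1
    refine eLpNorm_congr_norm_ae (Eventually.of_forall fun l => ?_)
    rw [norm_mul, norm_e, one_mul]

theorem modulation_ae (t : ℝ) (g : L2R) : modulation t g =ᵐ[volume] fun l => e (-l * t) * g l :=
  MemLp.coeFn_toLp (memLp_e_mul t (Lp.memLp g))

/-- Continuous operators on `L²` that agree on integrable functions are equal. -/
theorem eq_of_eq_on_integrable {μ : Measure ℝ} {E : Type*} [NormedAddCommGroup E] [NormedSpace ℂ E]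
    {S T : Lp ℂ 2 μ →L[ℂ] E} (h : ∀ f : Lp ℂ 2 μ, Integrable f μ → S f = T f) : S = T := by
  refine ContinuousLinearMap.ext fun f => ?_
  refine Lp.induction (by simp) (motive := fun f => S f = T f) ?_ ?_ ?_ f
  · intro c s hs hμ
    refine h _ ?_
    rw [Lp.simpleFunc.coe_indicatorConst]
    exact (integrable_indicator_iff hs |>.2 (by
      simpa using Or.inr hμ)).congr indicatorConstLp_coeFn.symm
  · intro f g hf hg _ h1 h2
    rw [map_add, map_add, h1, h2]
  · exact isClosed_eq S.continuous T.continuous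

theorem fourierL2_U0 (t : ℝ) (f : L2R) : fourierL2 (U0 t f) = modulation t (fourierL2 f) := by
  have h : fourierL2.toContinuousLinearEquiv.toContinuousLinearMap ∘L U0 t =
      (modulation t).toContinuousLinearMap ∘L
        fourierL2.toContinuousLinearEquiv.toContinuousLinearMap := by
    refine eq_of_eq_on_integrable fun f hf => Lp.ext ?_
    exact (fourierL2_U0_of_integrable t f hf).trans (modulation_ae t (fourierL2 f)).symm
  exact congrArg (fun T : L2R →L[ℂ] L2R => T f) h

theorem fourierL2_U0_ae (t : ℝ) (f : L2R) :
    fourierL2 (U0 t f) =ᵐ[volume] fun l => e (-l * t) * fourierL2 f l := by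
  rw [fourierL2_U0]
  exact modulation_ae t _

theorem fourierAdj_fourierL2 (f : L2R) : fourierAdj (fourierL2 f) = f :=
  fourierL2.symm_apply_apply f

theorem fourierL2_fourierAdj (f : L2R) : fourierL2 (fourierAdj f) = f :=
  fourierL2.apply_symm_apply f

end

end TwoIntervals

namespace TwoIntervals

noncomputable section

/-! ### Combinations of two translations -/

/-- The operator `z (U₀(a) - σ U₀(b))` on `L²(ℝ)`. -/
def shiftComb (z : ℂ) (a : ℝ) (σ : ℂ) (b : ℝ) : L2R →L[ℂ] L2R := z • (U0 a - σ • U0 b)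

theorem shiftComb_apply (z : ℂ) (a : ℝ) (σ : ℂ) (b : ℝ) (u : L2R) :
    shiftComb z a σ b u = z • (U0 a u - σ • U0 b u) := rfl

theorem shiftComb_U0 (z : ℂ) (a : ℝ) (σ : ℂ) (b t : ℝ) (u : L2R) :
    shiftComb z a σ b (U0 t u) = U0 t (shiftComb z a σ b u) := by
  simp only [shiftComb_apply, map_smul, map_sub, U0_U0, add_comm t]

theorem shiftComb_adjoint (z : ℂ) (a : ℝ) (σ : ℂ) (b : ℝ) :
    (shiftComb z a σ b).adjoint =
      shiftComb ((starRingEnd ℂ) z) (-a) ((starRingEnd ℂ) σ) (-b) := by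
  rw [shiftComb, shiftComb, map_smulₛₗ, map_sub, map_smulₛₗ, U0_adjoint, U0_adjoint]

theorem isUnit_U0 (a : ℝ) : IsUnit (U0 a) := by
  refine ⟨⟨U0 a, U0 (-a), ?_, ?_⟩, rfl⟩ <;>
  · refine ContinuousLinearMap.ext fun u => ?_
    rw [mul_apply_eq_comp, U0_U0]
    simp [U0_zero]

/-- Factoring out `z` and `U0 a` leaves `1 - σ U0 (b - a)`, inverted by a Neumann series since
translations are isometric. -/
theorem isUnit_shiftComb {z : ℂ} (a : ℝ) {σ : ℂ} (b : ℝ) (hz : z ≠ 0) (hσ : ‖σ‖ < 1) :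
    IsUnit (shiftComb z a σ b) := by
  have h1 : shiftComb z a σ b = z • (U0 a * (1 - σ • U0 (b - a))) := by
    refine ContinuousLinearMap.ext fun u => ?_
    simp [shiftComb_apply, U0_U0]
  have h2 : ‖σ • U0 (b - a)‖ < 1 := by
    refine lt_of_le_of_lt (ContinuousLinearMap.opNorm_le_bound _ (norm_nonneg σ) fun u => ?_) hσ
    rw [smul_apply, norm_smul, norm_U0]
  rw [h1]
  exact ((isUnit_U0 a).mul (isUnit_one_sub_of_norm_lt_one h2)).smul (Units.mk0 z hz)

theorem fourierL2_shiftComb (z : ℂ) (a : ℝ) (σ : ℂ) (b : ℝ) (u : L2R) :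
    fourierL2 (shiftComb z a σ b u) =ᵐ[volume]
      fun l => z * (e (-l * a) - σ * e (-l * b)) * fourierL2 u l := by
  rw [shiftComb_apply, map_smul, map_sub, map_smul]
  filter_upwards [Lp.coeFn_smul z (fourierL2 (U0 a u) - σ • fourierL2 (U0 b u)),
    Lp.coeFn_sub (fourierL2 (U0 a u)) (σ • fourierL2 (U0 b u)),
    Lp.coeFn_smul σ (fourierL2 (U0 b u)), fourierL2_U0_ae a u, fourierL2_U0_ae b u]
    with l h1 h2 h3 h4 h5
  rw [h1, Pi.smul_apply, h2, Pi.sub_apply, h3, Pi.smul_apply, h4, h5, smul_eq_mul, smul_eq_mul]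
  ring

theorem IsPrim.shiftComb {p r : L2R} {τ : ℝ → ℂ} (z : ℂ) (a : ℝ) (σ : ℂ) (b : ℝ)
    (h : IsPrim p r τ) :
    IsPrim (shiftComb z a σ b p) (shiftComb z a σ b r) fun x =>
      z * (τ (x - a) + prim r (-a) - σ * (τ (x - b) + prim r (-b))) :=
  ((h.translate a).sub ((h.translate b).smul σ)).smul z

/-! ### The operators with symbols `a` and `c` -/

variable {α β w θ φ ψ : ℝ}

variable (α w φ ψ) in
/-- The translation-invariant operator with symbol `a`. -/
def opA : L2R →L[ℂ] L2R :=
  shiftComb ((w : ℂ)⁻¹ * e φ) (-1) (Real.sqrt (1 - w ^ 2) * e (-ψ)) (-α)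

variable (α β w θ φ ψ) in
/-- The translation-invariant operator with symbol `c`. -/
def opC : L2R →L[ℂ] L2R :=
  shiftComb ((w : ℂ)⁻¹ * e (φ - θ)) (β - α) (Real.sqrt (1 - w ^ 2) * e ψ) (β - 1)

theorem opA_adjoint : (opA α w φ ψ).adjoint =
    shiftComb ((w : ℂ)⁻¹ * e (-φ)) 1 (Real.sqrt (1 - w ^ 2) * e ψ) α := by
  rw [opA, shiftComb_adjoint]
  simp [conj_e]

theorem opC_adjoint : (opC α β w θ φ ψ).adjoint =
    shiftComb ((w : ℂ)⁻¹ * e (θ - φ)) (α - β) (Real.sqrt (1 - w ^ 2) * e (-ψ)) (1 - β) := by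
  rw [opC, shiftComb_adjoint]
  simp [conj_e]

theorem sqrt_lt_one (hw0 : 0 < w) : Real.sqrt (1 - w ^ 2) < 1 := by
  rw [Real.sqrt_lt' one_pos]
  nlinarith

theorem norm_sqrt_mul_e_lt_one (hw0 : 0 < w) (x : ℝ) :
    ‖(Real.sqrt (1 - w ^ 2) : ℂ) * e x‖ < 1 := by
  rw [norm_mul, norm_e, mul_one, Complex.norm_real, Real.norm_of_nonneg (Real.sqrt_nonneg _)]
  exact sqrt_lt_one hw0

theorem inv_mul_e_ne_zero (hw0 : 0 < w) (x : ℝ) : (w : ℂ)⁻¹ * e x ≠ 0 :=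
  mul_ne_zero (inv_ne_zero (Complex.ofReal_ne_zero.2 hw0.ne')) (e_ne_zero x)

theorem sq_add_sqrt_sq (hw0 : 0 < w) (hw1 : w ≤ 1) :
    (w : ℂ) ^ 2 + (Real.sqrt (1 - w ^ 2) : ℂ) ^ 2 = 1 := by
  rw [← Complex.ofReal_pow, ← Complex.ofReal_pow, Real.sq_sqrt (by nlinarith)]
  push_cast
  ring

/-- The boundary matrix preserves norms. -/
theorem norm_sq_boundary {E : Type*} [NormedAddCommGroup E] [InnerProductSpace ℂ E]
    (hw0 : 0 < w) (hw1 : w ≤ 1) (y z : E) :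
    ‖((w : ℂ) * e φ) • y - (Real.sqrt (1 - w ^ 2) * e (θ - ψ)) • z‖ ^ 2 +
      ‖(Real.sqrt (1 - w ^ 2) * e ψ) • y + ((w : ℂ) * e (θ - φ)) • z‖ ^ 2 =
      ‖y‖ ^ 2 + ‖z‖ ^ 2 := by
  have hs : Real.sqrt (1 - w ^ 2) ^ 2 = 1 - w ^ 2 := Real.sq_sqrt (by nlinarith)
  -- Orthogonality of the two columns of `B`; it makes the cross terms cancel.
  have hc : (starRingEnd ℂ) ((w : ℂ) * e φ) * (Real.sqrt (1 - w ^ 2) * e (θ - ψ)) =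
      (starRingEnd ℂ) (Real.sqrt (1 - w ^ 2) * e ψ) * ((w : ℂ) * e (θ - φ)) := by
    simp only [map_mul, conj_e, Complex.conj_ofReal, sub_eq_add_neg, e_add]
    ring
  have hi : inner ℂ (((w : ℂ) * e φ) • y) ((Real.sqrt (1 - w ^ 2) * e (θ - ψ)) • z) =
      inner ℂ ((Real.sqrt (1 - w ^ 2) * e ψ) • y) (((w : ℂ) * e (θ - φ)) • z) := by
    simp only [inner_smul_left, inner_smul_right]
    linear_combination inner ℂ y z * hc
  rw [@norm_sub_sq ℂ, @norm_add_sq ℂ, hi]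
  simp only [norm_smul, norm_mul, norm_e, Complex.norm_real, mul_pow, Real.norm_eq_abs, sq_abs,
    mul_one]
  rw [hs]
  ring

/-- First row of the boundary condition, at all translates at once; `U0_eq` is the second row. The
phases match, and the modulus of the coefficient of `U0 (-1) k` comes from `w² + (1 - w²) = 1`. -/
theorem opA_eq (hw0 : 0 < w) (hw1 : w ≤ 1) (k : L2R) :
    opA α w φ ψ k = ((w : ℂ) * e φ) • U0 (-1) k -
      (Real.sqrt (1 - w ^ 2) * e (θ - ψ)) • U0 (-β) (opC α β w θ φ ψ k) := by
  have hw : (w : ℂ) ≠ 0 := Complex.ofReal_ne_zero.2 hw0.ne'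
  have hs := sq_add_sqrt_sq hw0 hw1
  rw [opA, opC, shiftComb_apply, shiftComb_apply, map_smul, map_sub, map_smul, U0_U0, U0_U0,
    show -β + (β - α) = -α by ring, show -β + (β - 1) = -1 by ring]
  match_scalars
  · have h1 : e (θ - ψ) * e (φ - θ) * e ψ = e φ := by
      rw [← e_add, ← e_add]; congr 1; ring
    field_simp
    linear_combination (-(e φ)) * hs - (Real.sqrt (1 - w ^ 2) : ℂ) ^ 2 * h1
  · have h1 : e (θ - ψ) * e (φ - θ) = e φ * e (-ψ) := by
      rw [← e_add, ← e_add]; congr 1; ring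
    field_simp
    linear_combination (Real.sqrt (1 - w ^ 2) : ℂ) * h1

theorem U0_eq (hw0 : 0 < w) (k : L2R) :
    U0 (-α) k = (Real.sqrt (1 - w ^ 2) * e ψ) • U0 (-1) k +
      ((w : ℂ) * e (θ - φ)) • U0 (-β) (opC α β w θ φ ψ k) := by
  have hw : (w : ℂ) ≠ 0 := Complex.ofReal_ne_zero.2 hw0.ne'
  have h1 : e (θ - φ) * e (φ - θ) = 1 := by
    rw [← e_add, ← e_zero]; congr 1; ring
  rw [opC, shiftComb_apply, map_smul, map_sub, map_smul, U0_U0, U0_U0,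
    show -β + (β - α) = -α by ring, show -β + (β - 1) = -1 by ring]
  match_scalars
  · field_simp
    linear_combination -h1
  · field_simp
    linear_combination (Real.sqrt (1 - w ^ 2) * e ψ : ℂ) * h1

/-- Unitarity of `B` integrated over all of `ℝ`; the term `‖k‖²` occurs on both sides and cancels.
-/
theorem norm_opC_eq (hw0 : 0 < w) (hw1 : w ≤ 1) (k : L2R) :
    ‖opC α β w θ φ ψ k‖ = ‖opA α w φ ψ k‖ := by
  have h := norm_sq_boundary (θ := θ) (φ := φ) (ψ := ψ) hw0 hw1 (U0 (-1) k)
    (U0 (-β) (opC α β w θ φ ψ k))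
  rw [← opA_eq hw0 hw1, ← U0_eq hw0] at h
  simp only [norm_U0] at h
  rw [← sq_eq_sq₀ (norm_nonneg _) (norm_nonneg _)]
  linarith

/-! ### Gluing -/

theorem norm_restr_eq_norm_cut {s : Set ℝ} (hs : MeasurableSet s) (u : L2R) :
    ‖restr s u‖ = ‖cut hs u‖ :=
  ((zeroExt hs).norm_map (restr s u)).symm

theorem measurableSet_Omega : MeasurableSet (Omega α β) := (isOpen_Omega α β).measurableSet

theorem norm_restr_Omega_sq (hα : 1 < α) (hαβ : α < β) (u : L2R) :
    ‖restr (Omega α β) u‖ ^ 2 = ‖cut (measurableSet_Iio (a := (0 : ℝ))) u‖ ^ 2 +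
      ‖cut (measurableSet_Ioo (a := (1 : ℝ)) (b := α)) u‖ ^ 2 +
      ‖cut (measurableSet_Ioi (a := β)) u‖ ^ 2 := by
  have hi := integrable_norm_sq u
  rw [norm_restr_eq_norm_cut measurableSet_Omega, norm_cut_sq, norm_cut_sq, norm_cut_sq,
    norm_cut_sq, Omega, setIntegral_union _ measurableSet_Ioi hi.integrableOn hi.integrableOn,
    setIntegral_union _ measurableSet_Ioo hi.integrableOn hi.integrableOn]
  · refine Set.disjoint_left.2 fun x h1 h2 => ?_
    simp only [mem_Iio, mem_Ioo] at h1 h2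
    linarith
  · refine Set.disjoint_left.2 fun x h1 h2 => ?_
    simp only [mem_union, mem_Iio, mem_Ioo, mem_Ioi] at h1 h2
    rcases h1 with h1 | h1 <;> linarith [h1]

variable (α β w θ φ ψ) in
/-- The function on `Ω` that is `A k`, `k`, `C k` on the three intervals. -/
def glue : L2R →L[ℂ] L2Omega α β :=
  restr (Omega α β) ∘L (cut (measurableSet_Iio (a := (0 : ℝ))) ∘L opA α w φ ψ +
    cut (measurableSet_Ioo (a := (1 : ℝ)) (b := α)) +
    cut (measurableSet_Ioi (a := β)) ∘L opC α β w θ φ ψ)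

theorem glue_adjoint (f : L2Omega α β) :
    (glue α β w θ φ ψ).adjoint f =
      (opA α w φ ψ).adjoint (cut (measurableSet_Iio (a := (0 : ℝ))) (zeroExt measurableSet_Omega f)) +
      cut (measurableSet_Ioo (a := (1 : ℝ)) (b := α)) (zeroExt measurableSet_Omega f) +
      (opC α β w θ φ ψ).adjoint (cut (measurableSet_Ioi (a := β)) (zeroExt measurableSet_Omega f)) := by
  rw [glue, ContinuousLinearMap.adjoint_comp, map_add, map_add, ContinuousLinearMap.adjoint_comp,
    ContinuousLinearMap.adjoint_comp, cut_adjoint, cut_adjoint, cut_adjoint,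
    restr_adjoint measurableSet_Omega]
  rfl

theorem disjoint_Iio_Ioo {a b c : ℝ} (h : a ≤ b) : Disjoint (Iio a) (Ioo b c) :=
  Set.disjoint_left.2 fun x h1 h2 => by linarith [mem_Iio.1 h1, h2.1]

theorem disjoint_Iio_Ioi {a b : ℝ} (h : a ≤ b) : Disjoint (Iio a) (Ioi b) :=
  Set.disjoint_left.2 fun x h1 h2 => by linarith [mem_Iio.1 h1, mem_Ioi.1 h2]

theorem disjoint_Ioo_Ioi {a b c : ℝ} (h : b ≤ c) : Disjoint (Ioo a b) (Ioi c) :=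
  Set.disjoint_left.2 fun x h1 h2 => by linarith [h1.2, mem_Ioi.1 h2]

theorem norm_glue_sq (hα : 1 < α) (hαβ : α < β) (k : L2R) :
    ‖glue α β w θ φ ψ k‖ ^ 2 = ‖cut (measurableSet_Iio (a := (0 : ℝ))) (opA α w φ ψ k)‖ ^ 2 +
      ‖cut (measurableSet_Ioo (a := (1 : ℝ)) (b := α)) k‖ ^ 2 +
      ‖cut (measurableSet_Ioi (a := β)) (opC α β w θ φ ψ k)‖ ^ 2 := by
  have h1 : Disjoint (Iio (0 : ℝ)) (Ioo 1 α) := disjoint_Iio_Ioo zero_le_one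
  have h2 : Disjoint (Iio (0 : ℝ)) (Ioi β) := disjoint_Iio_Ioi (by linarith)
  have h3 : Disjoint (Ioo 1 α) (Ioi β) := disjoint_Ioo_Ioi hαβ.le
  rw [glue, ContinuousLinearMap.comp_apply, norm_restr_Omega_sq hα hαβ]
  simp only [add_apply, ContinuousLinearMap.comp_apply, map_add, cut_cut_of_subset _ _ subset_rfl,
    cut_cut_of_disjoint _ _ h1, cut_cut_of_disjoint _ _ h2, cut_cut_of_disjoint _ _ h3,
    cut_cut_of_disjoint _ _ h1.symm, cut_cut_of_disjoint _ _ h2.symm,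
    cut_cut_of_disjoint _ _ h3.symm, add_zero, zero_add]

theorem norm_cut_Ioi_U0_neg (r : ℝ) (u : L2R) :
    ‖cut (measurableSet_Ioi (a := (0 : ℝ))) (U0 (-r) u)‖ =
      ‖cut (measurableSet_Ioi (a := r)) u‖ := by
  rw [cut_Ioi_U0, norm_U0, cut_congr (t := Ioi r) (ht := measurableSet_Ioi)]
  rw [zero_sub, neg_neg]

/-- Unitarity of `B` integrated over `x > 0` only. The mass of `k` beyond `α` cancels against part
of its mass beyond `1`, so the mass of `A k` on `(0,∞)` equals that of `k` on `(1,α)` plus that of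
`C k` on `(β,∞)`. -/
theorem norm_glue (hα : 1 < α) (hαβ : α < β) (hw0 : 0 < w) (hw1 : w ≤ 1) (k : L2R) :
    ‖glue α β w θ φ ψ k‖ = ‖opA α w φ ψ k‖ := by
  have h := norm_sq_boundary (θ := θ) (φ := φ) (ψ := ψ) hw0 hw1
    (cut (measurableSet_Ioi (a := (0 : ℝ))) (U0 (-1) k))
    (cut (measurableSet_Ioi (a := (0 : ℝ))) (U0 (-β) (opC α β w θ φ ψ k)))
  have ha := congrArg (cut (measurableSet_Ioi (a := (0 : ℝ))))
    (opA_eq (α := α) (β := β) (θ := θ) (φ := φ) (ψ := ψ) hw0 hw1 k)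
  have hb := congrArg (cut (measurableSet_Ioi (a := (0 : ℝ))))
    (U0_eq (α := α) (β := β) (θ := θ) (φ := φ) (ψ := ψ) hw0 k)
  rw [map_sub, map_smul, map_smul] at ha
  rw [map_add, map_smul, map_smul] at hb
  rw [← ha, ← hb, norm_cut_Ioi_U0_neg, norm_cut_Ioi_U0_neg, norm_cut_Ioi_U0_neg,
    norm_cut_Ioi_sq hα k] at h
  rw [← sq_eq_sq₀ (norm_nonneg _) (norm_nonneg _), norm_glue_sq hα hαβ,
    norm_sq_eq_cut_add 0 (opA α w φ ψ k)]
  linarith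

/-- A function supported in a half-line that is reproduced up to a contraction vanishes. -/
theorem eq_zero_of_cut_shiftComb {s : Set ℝ} (hs : MeasurableSet s) {z σ : ℂ} {a b : ℝ} {u : L2R}
    (hz : z ≠ 0) (hσ : ‖σ‖ < 1) (hu : cut hs (U0 a u) = U0 a u)
    (h : cut hs (shiftComb z a σ b u) = 0) : u = 0 := by
  rw [shiftComb_apply, map_smul, map_sub, map_smul, hu, smul_eq_zero_iff_right hz,
    sub_eq_zero] at h
  have h1 : ‖u‖ ≤ ‖σ‖ * ‖u‖ := by
    calc ‖u‖ = ‖U0 a u‖ := (norm_U0 a u).symm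
      _ = ‖σ‖ * ‖cut hs (U0 b u)‖ := by rw [h, norm_smul]
      _ ≤ ‖σ‖ * ‖U0 b u‖ := by gcongr; exact norm_cut_le hs _
      _ = ‖σ‖ * ‖u‖ := by rw [norm_U0]
  have h2 : ‖u‖ = 0 := by nlinarith [norm_nonneg u]
  exact norm_eq_zero.1 h2

theorem cut_zeroExt_add (hα : 1 < α) (hαβ : α < β) (f : L2Omega α β)
    (h1 : cut (measurableSet_Iio (a := (0 : ℝ))) (zeroExt measurableSet_Omega f) = 0)
    (h2 : cut (measurableSet_Ioo (a := (1 : ℝ)) (b := α)) (zeroExt measurableSet_Omega f) = 0)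
    (h3 : cut (measurableSet_Ioi (a := β)) (zeroExt measurableSet_Omega f) = 0) : f = 0 := by
  have h := norm_restr_Omega_sq hα hαβ (zeroExt measurableSet_Omega f)
  rw [restr_zeroExt, h1, h2, h3] at h
  simpa using h

/-- The adjoint of the gluing operator is injective. -/
theorem glue_adjoint_eq_zero (hα : 1 < α) (hαβ : α < β) (hw0 : 0 < w) {f : L2Omega α β}
    (hf : (glue α β w θ φ ψ).adjoint f = 0) : f = 0 := by
  rw [glue_adjoint, opA_adjoint, opC_adjoint] at hf
  set u := zeroExt measurableSet_Omega f
  -- On `(-∞,1)` only the `A*` term of the adjoint survives: the `C*` term lives in `(1,∞)`, since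
  -- its shifts move `β` to `α` and to `1`. The leading part `U0 1` of `A*` carries `(-∞,0)` exactly
  -- onto this window.
  have h1 : cut (measurableSet_Iio (a := (0 : ℝ))) u = 0 := by
    have h := congrArg (cut (measurableSet_Iio (a := (1 : ℝ)))) hf
    rw [map_add, map_add, map_zero, cut_cut_of_disjoint _ _ (disjoint_Iio_Ioo le_rfl), add_zero,
      shiftComb_apply _ _ _ _ (cut (measurableSet_Ioi (a := β)) u)] at h
    simp only [map_smul, map_sub, cut_Iio_U0 1] at h
    rw [cut_cut_of_disjoint _ (measurableSet_Ioi (a := β)) (disjoint_Iio_Ioi (by linarith)),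
      cut_cut_of_disjoint _ (measurableSet_Ioi (a := β)) (disjoint_Iio_Ioi (by linarith))] at h
    simp only [map_zero, smul_zero, sub_zero, add_zero] at h
    refine eq_zero_of_cut_shiftComb _ (inv_mul_e_ne_zero hw0 _) (norm_sqrt_mul_e_lt_one hw0 _) ?_ h
    rw [cut_Iio_U0, cut_cut_of_subset]
    simp
  -- With the left piece gone, the window `(α,∞)` misses the middle piece, and it is exactly where
  -- `U0 (α - β)` carries `(β,∞)`.
  have h3 : cut (measurableSet_Ioi (a := β)) u = 0 := by
    have h := congrArg (cut (measurableSet_Ioi (a := α))) hf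
    rw [h1, map_zero, zero_add, map_add, map_zero,
      cut_cut_of_disjoint _ _ (disjoint_Ioo_Ioi le_rfl).symm, zero_add] at h
    refine eq_zero_of_cut_shiftComb _ (inv_mul_e_ne_zero hw0 _) (norm_sqrt_mul_e_lt_one hw0 _) ?_ h
    rw [cut_Ioi_U0, cut_cut_of_subset]
    simp
  have h2 : cut (measurableSet_Ioo (a := (1 : ℝ)) (b := α)) u = 0 := by
    simpa [h1, h3] using hf
  exact cut_zeroExt_add hα hαβ f h1 h2 h3

/-! ### The unitary operators `R_±` -/

variable (α β w θ φ ψ) in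
/-- The translation-invariant operator normalizing the eigenfunctions. -/
def opSide : Side → L2R →L[ℂ] L2R
  | .outgoing => opC α β w θ φ ψ
  | .incoming => opA α w φ ψ

theorem isUnit_opSide (hw0 : 0 < w) (κ : Side) : IsUnit (opSide α β w θ φ ψ κ) := by
  cases κ <;>
  exact isUnit_shiftComb _ _ (inv_mul_e_ne_zero hw0 _) (norm_sqrt_mul_e_lt_one hw0 _)

theorem opSide_U0 (κ : Side) (t : ℝ) (u : L2R) :
    opSide α β w θ φ ψ κ (U0 t u) = U0 t (opSide α β w θ φ ψ κ u) := by
  cases κ <;> exact shiftComb_U0 _ _ _ _ _ _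

theorem norm_glue_eq_opSide (hα : 1 < α) (hαβ : α < β) (hw0 : 0 < w) (hw1 : w ≤ 1) (κ : Side)
    (k : L2R) : ‖glue α β w θ φ ψ k‖ = ‖opSide α β w θ φ ψ κ k‖ := by
  cases κ
  · rw [norm_glue hα hαβ hw0 hw1]; exact (norm_opC_eq hw0 hw1 k).symm
  · exact norm_glue hα hαβ hw0 hw1 k

variable (α β w θ φ ψ) in
/-- The adjoint of the translation representation. -/
def transAdj (κ : Side) : L2R →L[ℂ] L2Omega α β :=
  glue α β w θ φ ψ ∘L Ring.inverse (opSide α β w θ φ ψ κ)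

/-- `Ring.inverse` is `0` on non-units; `0 < w` makes it a genuine inverse here. -/
theorem opSide_inverse (hw0 : 0 < w) (κ : Side) (u : L2R) :
    opSide α β w θ φ ψ κ (Ring.inverse (opSide α β w θ φ ψ κ) u) = u :=
  congrArg (fun T : L2R →L[ℂ] L2R => T u) (Ring.mul_inverse_cancel _ (isUnit_opSide hw0 κ))

theorem inverse_opSide (hw0 : 0 < w) (κ : Side) (u : L2R) :
    Ring.inverse (opSide α β w θ φ ψ κ) (opSide α β w θ φ ψ κ u) = u :=
  congrArg (fun T : L2R →L[ℂ] L2R => T u) (Ring.inverse_mul_cancel _ (isUnit_opSide hw0 κ))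

theorem norm_transAdj (hα : 1 < α) (hαβ : α < β) (hw0 : 0 < w) (hw1 : w ≤ 1) (κ : Side)
    (u : L2R) : ‖transAdj α β w θ φ ψ κ u‖ = ‖u‖ := by
  rw [transAdj, ContinuousLinearMap.comp_apply, norm_glue_eq_opSide hα hαβ hw0 hw1 κ,
    opSide_inverse hw0]

/-- This is `T* = (S*)⁻¹ G*` without the inverse. Surjectivity, the integral formula, the action on
`D_±` and the generator are all deduced through it. -/
theorem opSide_adjoint_transAdj_adjoint (hw0 : 0 < w) (κ : Side) (f : L2Omega α β) :
    (opSide α β w θ φ ψ κ).adjoint ((transAdj α β w θ φ ψ κ).adjoint f) =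
      (glue α β w θ φ ψ).adjoint f := by
  rw [← ContinuousLinearMap.comp_apply, ← ContinuousLinearMap.adjoint_comp]
  congr 2
  refine ContinuousLinearMap.ext fun u => ?_
  simp [transAdj, inverse_opSide hw0]

theorem opSide_adjoint_injective (hw0 : 0 < w) (κ : Side) :
    Function.Injective (opSide α β w θ φ ψ κ).adjoint := by
  have h : (Ring.inverse (opSide α β w θ φ ψ κ)).adjoint ∘L (opSide α β w θ φ ψ κ).adjoint =
      ContinuousLinearMap.id ℂ L2R := by
    rw [← ContinuousLinearMap.adjoint_comp]
    have : opSide α β w θ φ ψ κ ∘L Ring.inverse (opSide α β w θ φ ψ κ) =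
      ContinuousLinearMap.id ℂ L2R := ContinuousLinearMap.ext (opSide_inverse hw0 κ)
    rw [this, ContinuousLinearMap.adjoint_id]
  exact Function.LeftInverse.injective
    (g := (Ring.inverse (opSide α β w θ φ ψ κ)).adjoint) fun u =>
    congrArg (fun T : L2R →L[ℂ] L2R => T u) h

theorem adjoint_transAdj (hα : 1 < α) (hαβ : α < β) (hw0 : 0 < w) (hw1 : w ≤ 1) (κ : Side)
    (u : L2R) : (transAdj α β w θ φ ψ κ).adjoint (transAdj α β w θ φ ψ κ u) = u :=
  congrArg (fun T : L2R →L[ℂ] L2R => T u)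
    ((ContinuousLinearMap.norm_map_iff_adjoint_comp_self _).1 (norm_transAdj hα hαβ hw0 hw1 κ))

/-- Since `T* T = 1`, the vector `T T* f - f` is killed by `T*`, hence by `G* = S* T*`, which is
injective. -/
theorem transAdj_adjoint (hα : 1 < α) (hαβ : α < β) (hw0 : 0 < w) (hw1 : w ≤ 1) (κ : Side)
    (f : L2Omega α β) : transAdj α β w θ φ ψ κ ((transAdj α β w θ φ ψ κ).adjoint f) = f := by
  rw [← sub_eq_zero]
  refine glue_adjoint_eq_zero (θ := θ) (φ := φ) (ψ := ψ) hα hαβ hw0 ?_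
  rw [← opSide_adjoint_transAdj_adjoint hw0 κ, map_sub, adjoint_transAdj hα hαβ hw0 hw1, sub_self,
    map_zero]

end

end TwoIntervals

namespace TwoIntervals

noncomputable section

variable {α β w θ φ ψ : ℝ}

/-! ### The transforms `V_±` -/

theorem Iio_subset_Omega : Iio 0 ⊆ Omega α β := fun _ h => Or.inl (Or.inl h)

theorem Ioo_subset_Omega : Ioo 1 α ⊆ Omega α β := fun _ h => Or.inl (Or.inr h)

theorem Ioi_subset_Omega : Ioi β ⊆ Omega α β := fun _ h => Or.inr h

theorem conj_coeffA (l : ℝ) : (starRingEnd ℂ) (coeffA α w φ ψ l) =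
    (w : ℂ)⁻¹ * e (-φ) * (e (-l * 1) - Real.sqrt (1 - w ^ 2) * e ψ * e (-l * α)) := by
  have h : e (-l) * e (-(-ψ + (α - 1) * l)) = e ψ * e (-l * α) := by
    rw [← e_add, ← e_add]; congr 1; ring
  simp only [coeffA, map_mul, map_sub, map_one, map_inv₀, conj_e, Complex.conj_ofReal, mul_one]
  linear_combination (-(w : ℂ)⁻¹ * e (-φ) * Real.sqrt (1 - w ^ 2)) * h

theorem conj_coeffC (l : ℝ) : (starRingEnd ℂ) (coeffC α β w θ φ ψ l) =
    (w : ℂ)⁻¹ * e (θ - φ) *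
      (e (-l * (α - β)) - Real.sqrt (1 - w ^ 2) * e (-ψ) * e (-l * (1 - β))) := by
  have h : e (-(-(β - α) * l)) * e (-(ψ - (α - 1) * l)) = e (-ψ) * e (-l * (1 - β)) := by
    rw [← e_add, ← e_add]; congr 1; ring
  have h1 : e (-(-(β - α) * l)) = e (-l * (α - β)) := by congr 1; ring
  simp only [coeffC, map_mul, map_sub, map_one, map_inv₀, conj_e, Complex.conj_ofReal, neg_sub φ θ]
  linear_combination (-(w : ℂ)⁻¹ * e (θ - φ) * Real.sqrt (1 - w ^ 2)) * h +
    (w : ℂ)⁻¹ * e (θ - φ) * h1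

theorem one_sub_sqrt_mul_e_ne_zero (hw0 : 0 < w) (x : ℝ) :
    1 - (Real.sqrt (1 - w ^ 2) : ℂ) * e x ≠ 0 := by
  intro h
  have := norm_sqrt_mul_e_lt_one hw0 x
  rw [← sub_eq_zero.1 h, norm_one] at this
  exact lt_irrefl _ this

theorem coeffA_ne_zero (hw0 : 0 < w) (l : ℝ) : coeffA α w φ ψ l ≠ 0 :=
  mul_ne_zero (mul_ne_zero (inv_mul_e_ne_zero hw0 _) (e_ne_zero _))
    (one_sub_sqrt_mul_e_ne_zero hw0 _)

theorem coeffC_ne_zero (hw0 : 0 < w) (l : ℝ) : coeffC α β w θ φ ψ l ≠ 0 :=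
  mul_ne_zero (mul_ne_zero (inv_mul_e_ne_zero hw0 _) (e_ne_zero _))
    (one_sub_sqrt_mul_e_ne_zero hw0 _)

variable (α β w θ φ ψ) in
/-- The symbol of `opSide`. -/
def coeffSide : Side → ℝ → ℂ
  | .outgoing => coeffC α β w θ φ ψ
  | .incoming => coeffA α w φ ψ

theorem fourierL2_opA_adjoint (u : L2R) : fourierL2 ((opA α w φ ψ).adjoint u) =ᵐ[volume]
    fun l => (starRingEnd ℂ) (coeffA α w φ ψ l) * fourierL2 u l := by
  rw [opA_adjoint]
  simp_rw [conj_coeffA]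
  exact fourierL2_shiftComb _ _ _ _ u

theorem fourierL2_opC_adjoint (u : L2R) : fourierL2 ((opC α β w θ φ ψ).adjoint u) =ᵐ[volume]
    fun l => (starRingEnd ℂ) (coeffC α β w θ φ ψ l) * fourierL2 u l := by
  rw [opC_adjoint]
  simp_rw [conj_coeffC]
  exact fourierL2_shiftComb _ _ _ _ u

theorem fourierL2_opSide_adjoint (κ : Side) (u : L2R) :
    fourierL2 ((opSide α β w θ φ ψ κ).adjoint u) =ᵐ[volume]
      fun l => (starRingEnd ℂ) (coeffSide α β w θ φ ψ κ l) * fourierL2 u l := by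
  cases κ
  · exact fourierL2_opC_adjoint u
  · exact fourierL2_opA_adjoint u

theorem cut_zeroExt_ae {s : Set ℝ} (hs : MeasurableSet s) (h : s ⊆ Omega α β)
    (f : L2Omega α β) : cut hs (zeroExt measurableSet_Omega f) =ᵐ[volume] s.indicator f := by
  filter_upwards [cut_ae hs (zeroExt measurableSet_Omega f), zeroExt_ae measurableSet_Omega f]
    with x h1 h2
  rw [h1]
  by_cases hx : x ∈ s
  · rw [indicator_of_mem hx, indicator_of_mem hx, h2, indicator_of_mem (h hx)]
  · rw [indicator_of_notMem hx, indicator_of_notMem hx]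

theorem fourierL2_cut_zeroExt {s : Set ℝ} (hs : MeasurableSet s) (h : s ⊆ Omega α β)
    {f : L2Omega α β} (hf : Integrable f (volume.restrict (Omega α β))) :
    fourierL2 (cut hs (zeroExt measurableSet_Omega f)) =ᵐ[volume]
      fun l => ∫ x in Omega α β, s.indicator (fun x => e (-(l * x)) * f x) x := by
  have h1 := cut_zeroExt_ae hs h f
  have hi : Integrable (s.indicator f) volume :=
    (integrable_indicator_iff hs).2 (IntegrableOn.mono_set hf h)
  filter_upwards [fourierL2_ae_of_integrable _ (hi.congr h1.symm)] with l h2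
  rw [h2, setIntegral_indicator hs, inter_eq_right.2 h, ← integral_indicator hs]
  refine integral_congr_ae ?_
  filter_upwards [h1] with x hx
  rw [hx]
  by_cases hxs : x ∈ s <;> simp [hxs]

theorem integrable_e_mul {f : L2Omega α β} (hf : Integrable f (volume.restrict (Omega α β)))
    (l : ℝ) : Integrable (fun x => e (-(l * x)) * f x) (volume.restrict (Omega α β)) := by
  refine hf.congr' ((Continuous.aestronglyMeasurable (by
    have := continuous_e; fun_prop)).mul hf.1) (Eventually.of_forall fun x => ?_)
  rw [norm_mul, norm_e, one_mul]

/-- The three terms of `G* f` have Fourier multipliers `conj a`, `1` and `conj c`, which are the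
conjugate coefficients of `ψ_l` on the three intervals. -/
theorem fourierL2_glue_adjoint {f : L2Omega α β} (hf : Integrable f (volume.restrict (Omega α β))) :
    fourierL2 ((glue α β w θ φ ψ).adjoint f) =ᵐ[volume] fun l =>
      ∫ x in Omega α β, (starRingEnd ℂ) (genEigenfunction α β w θ φ ψ l x) * f x := by
  rw [glue_adjoint, map_add, map_add]
  set u := zeroExt measurableSet_Omega f
  filter_upwards [Lp.coeFn_add (fourierL2 ((opA α w φ ψ).adjoint (cut measurableSet_Iio u)) +
      fourierL2 (cut measurableSet_Ioo u))
      (fourierL2 ((opC α β w θ φ ψ).adjoint (cut measurableSet_Ioi u))),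
    Lp.coeFn_add (fourierL2 ((opA α w φ ψ).adjoint (cut measurableSet_Iio u)))
      (fourierL2 (cut measurableSet_Ioo u)),
    fourierL2_opA_adjoint (α := α) (w := w) (φ := φ) (ψ := ψ) (cut measurableSet_Iio u),
    fourierL2_opC_adjoint (α := α) (β := β) (w := w) (θ := θ) (φ := φ) (ψ := ψ)
      (cut measurableSet_Ioi u),
    fourierL2_cut_zeroExt measurableSet_Iio Iio_subset_Omega hf,
    fourierL2_cut_zeroExt measurableSet_Ioo Ioo_subset_Omega hf,
    fourierL2_cut_zeroExt measurableSet_Ioi Ioi_subset_Omega hf] with l h1 h2 h3 h4 h5 h6 h7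
  have hi := integrable_e_mul hf l
  rw [h1, Pi.add_apply, h2, Pi.add_apply, h3, h4, h5, h6, h7, ← integral_const_mul,
    ← integral_const_mul, ← integral_add ((hi.indicator measurableSet_Iio).const_mul _)
      (hi.indicator measurableSet_Ioo)]
  refine (integral_add
    (((hi.indicator measurableSet_Iio).const_mul _).add (hi.indicator measurableSet_Ioo))
    ((hi.indicator measurableSet_Ioi).const_mul _)).symm.trans ?_
  refine integral_congr_ae (Eventually.of_forall fun x => ?_)
  simp only [Pi.add_apply, genEigenfunction, map_mul, map_add, conj_e, indicator]
  split_ifs <;> simp <;> ring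

theorem normEigenfunction_eq (κ : Side) (l x : ℝ) : normEigenfunction α β w θ φ ψ κ l x =
    (coeffSide α β w θ φ ψ κ l)⁻¹ * genEigenfunction α β w θ φ ψ l x := by
  cases κ <;> rfl

theorem coeffSide_ne_zero (hw0 : 0 < w) (κ : Side) (l : ℝ) : coeffSide α β w θ φ ψ κ l ≠ 0 := by
  cases κ
  · exact coeffC_ne_zero hw0 l
  · exact coeffA_ne_zero hw0 l

theorem isTransformOf_fourierL2 (hw0 : 0 < w) (κ : Side) :
    IsTransformOf (normEigenfunction α β w θ φ ψ κ)
      (fourierL2.toContinuousLinearEquiv.toContinuousLinearMap ∘L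
        (transAdj α β w θ φ ψ κ).adjoint) := by
  intro f hf
  change fourierL2 ((transAdj α β w θ φ ψ κ).adjoint f) =ᵐ[volume] _
  have h1 := fourierL2_opSide_adjoint (α := α) (β := β) (w := w) (θ := θ) (φ := φ) (ψ := ψ) κ
    ((transAdj α β w θ φ ψ κ).adjoint f)
  rw [opSide_adjoint_transAdj_adjoint hw0] at h1
  filter_upwards [h1, fourierL2_glue_adjoint hf] with l h1 h2
  simp_rw [normEigenfunction_eq, map_mul, map_inv₀, mul_assoc]
  rw [integral_const_mul, ← h2, h1, inv_mul_cancel_left₀]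
  exact (map_ne_zero _).2 (coeffSide_ne_zero hw0 κ l)

theorem IsTransformOf.unique {Ψ : ℝ → ℝ → ℂ} {S T : L2Omega α β →L[ℂ] L2R}
    (hS : IsTransformOf Ψ S) (hT : IsTransformOf Ψ T) : S = T :=
  eq_of_eq_on_integrable fun f hf => Lp.ext ((hS f hf).trans (hT f hf).symm)

/-- `V` is an arbitrary choice by `Classical.epsilon` until some operator with the property is
exhibited. -/
theorem V_spec (hw0 : 0 < w) (κ : Side) :
    IsTransformOf (normEigenfunction α β w θ φ ψ κ) (V α β w θ φ ψ κ) :=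
  Classical.epsilon_spec ⟨_, isTransformOf_fourierL2 hw0 κ⟩

theorem V_apply (hw0 : 0 < w) (κ : Side) (f : L2Omega α β) :
    V α β w θ φ ψ κ f = fourierL2 ((transAdj α β w θ φ ψ κ).adjoint f) := by
  rw [(V_spec hw0 κ).unique (isTransformOf_fourierL2 hw0 κ)]
  rfl

theorem R_eq (hw0 : 0 < w) (κ : Side) :
    R α β w θ φ ψ κ = (transAdj α β w θ φ ψ κ).adjoint := by
  refine ContinuousLinearMap.ext fun f => ?_
  rw [R, ContinuousLinearMap.comp_apply, V_apply hw0, fourierAdj_fourierL2]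

/-- The translation representation is the identity on `D_±`. -/
theorem R_apply_of_mem_D (hα : 1 < α) (hαβ : α < β) (hw0 : 0 < w) (κ : Side) {f : L2Omega α β}
    (hf : f ∈ D α β κ) : R α β w θ φ ψ κ f = zeroExt measurableSet_Omega f := by
  have hf' := (ae_restrict_iff' measurableSet_Omega).1 hf
  have hz : ∀ {s : Set ℝ} (hs : MeasurableSet s), s ⊆ Omega α β →
      Disjoint s (sideInterval β κ) → cut hs (zeroExt measurableSet_Omega f) = 0 := by
    intro s hs hsO hd
    refine Lp.ext ?_
    filter_upwards [cut_zeroExt_ae hs hsO f, hf', Lp.coeFn_zero ℂ 2 volume] with x h1 h2 h3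
    rw [h1, h3]
    by_cases hx : x ∈ s
    · rw [indicator_of_mem hx, h2 (hsO hx) (Set.disjoint_left.1 hd hx)]; rfl
    · rw [indicator_of_notMem hx]; rfl
  have hid : ∀ {s : Set ℝ} (hs : MeasurableSet s), s ⊆ Omega α β → s = sideInterval β κ →
      cut hs (zeroExt measurableSet_Omega f) = zeroExt measurableSet_Omega f := by
    intro s hs hsO h
    refine Lp.ext ?_
    filter_upwards [cut_zeroExt_ae hs hsO f, hf', zeroExt_ae measurableSet_Omega f] with x h1 h2 h3
    rw [h1, h3]
    by_cases hx : x ∈ s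
    · rw [indicator_of_mem hx, indicator_of_mem (hsO hx)]
    · rw [indicator_of_notMem hx]
      by_cases hxO : x ∈ Omega α β
      · rw [indicator_of_mem hxO, h2 hxO (h ▸ hx)]
      · rw [indicator_of_notMem hxO]
  rw [R_eq hw0]
  -- After applying `S*`, the left side becomes `G* f`, whose only nonzero term for `f ∈ D_±` is
  -- `S*` of the extension of `f`.
  refine opSide_adjoint_injective (α := α) (β := β) (θ := θ) (φ := φ) (ψ := ψ) hw0 κ ?_
  rw [opSide_adjoint_transAdj_adjoint hw0, glue_adjoint]
  cases κ
  · rw [hz measurableSet_Iio Iio_subset_Omega (disjoint_Iio_Ioi (by linarith)),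
      hz measurableSet_Ioo Ioo_subset_Omega (disjoint_Ioo_Ioi hαβ.le),
      hid measurableSet_Ioi Ioi_subset_Omega rfl, map_zero, zero_add, zero_add]
    rfl
  · rw [hid measurableSet_Iio Iio_subset_Omega rfl,
      hz measurableSet_Ioo Ioo_subset_Omega (disjoint_Iio_Ioo zero_le_one).symm,
      hz measurableSet_Ioi Ioi_subset_Omega (disjoint_Iio_Ioi (by linarith)).symm, map_zero,
      add_zero, add_zero]
    rfl

end

end TwoIntervals

namespace TwoIntervals

noncomputable section

variable {α β w θ φ ψ : ℝ}

/-! ### The group transported to `L²(Ω)` -/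

variable (α β w θ φ ψ) in
/-- The translation group, transported to `L²(Ω)`. -/
def transGroup (κ : Side) (t : ℝ) : L2Omega α β →L[ℂ] L2Omega α β :=
  transAdj α β w θ φ ψ κ ∘L U0 t ∘L (transAdj α β w θ φ ψ κ).adjoint

theorem adjoint_transGroup (hα : 1 < α) (hαβ : α < β) (hw0 : 0 < w) (hw1 : w ≤ 1) (κ : Side)
    (t : ℝ) (f : L2Omega α β) :
    (transAdj α β w θ φ ψ κ).adjoint (transGroup α β w θ φ ψ κ t f) =
      U0 t ((transAdj α β w θ φ ψ κ).adjoint f) :=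
  adjoint_transAdj hα hαβ hw0 hw1 κ _

theorem transGroup_adjoint (κ : Side) (t : ℝ) :
    (transGroup α β w θ φ ψ κ t).adjoint = transGroup α β w θ φ ψ κ (-t) := by
  rw [transGroup, ContinuousLinearMap.adjoint_comp, ContinuousLinearMap.adjoint_comp,
    ContinuousLinearMap.adjoint_adjoint, U0_adjoint]
  rfl

theorem transGroup_add (hα : 1 < α) (hαβ : α < β) (hw0 : 0 < w) (hw1 : w ≤ 1) (κ : Side)
    (s t : ℝ) : transGroup α β w θ φ ψ κ (s + t) =
      transGroup α β w θ φ ψ κ s ∘L transGroup α β w θ φ ψ κ t := by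
  refine ContinuousLinearMap.ext fun f => ?_
  change _ = transAdj α β w θ φ ψ κ (U0 s ((transAdj α β w θ φ ψ κ).adjoint
    (transGroup α β w θ φ ψ κ t f)))
  rw [adjoint_transGroup hα hαβ hw0 hw1, U0_U0]
  rfl

theorem transGroup_zero (hα : 1 < α) (hαβ : α < β) (hw0 : 0 < w) (hw1 : w ≤ 1) (κ : Side) :
    transGroup α β w θ φ ψ κ 0 = ContinuousLinearMap.id ℂ _ := by
  refine ContinuousLinearMap.ext fun f => ?_
  change transAdj α β w θ φ ψ κ (U0 0 _) = f
  rw [U0_zero]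
  exact transAdj_adjoint hα hαβ hw0 hw1 κ f

theorem transGroup_mem_unitary (hα : 1 < α) (hαβ : α < β) (hw0 : 0 < w) (hw1 : w ≤ 1) (κ : Side)
    (t : ℝ) : transGroup α β w θ φ ψ κ t ∈ unitary (L2Omega α β →L[ℂ] L2Omega α β) := by
  have h := transGroup_zero (θ := θ) (φ := φ) (ψ := ψ) hα hαβ hw0 hw1 κ
  rw [Unitary.mem_iff, ContinuousLinearMap.star_eq_adjoint, transGroup_adjoint]
  constructor
  · refine (transGroup_add hα hαβ hw0 hw1 κ _ _).symm.trans ?_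
    rw [neg_add_cancel]
    exact h
  · refine (transGroup_add hα hαβ hw0 hw1 κ _ _).symm.trans ?_
    rw [add_neg_cancel]
    exact h

/-- The generator of the transported group, in terms of primitives. -/
theorem tendsto_transGroup_iff (hα : 1 < α) (hαβ : α < β) (hw0 : 0 < w) (hw1 : w ≤ 1) (κ : Side)
    (f g : L2Omega α β) :
    Tendsto (fun t : ℝ => ((t : ℂ)⁻¹) • (transGroup α β w θ φ ψ κ t f - f)) (𝓝[≠] 0)
      (𝓝 (-(2 * Real.pi * Complex.I) • g)) ↔
    ∃ c : ℂ, IsPrim ((transAdj α β w θ φ ψ κ).adjoint f)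
      ((transAdj α β w θ φ ψ κ).adjoint ((2 * Real.pi * Complex.I : ℂ) • g)) fun _ => c := by
  constructor
  · intro h
    refine IsPrim.of_tendsto ?_
    have h1 := ((transAdj α β w θ φ ψ κ).adjoint.continuous.tendsto _).comp h
    rw [neg_smul, map_neg] at h1
    refine h1.congr fun t => ?_
    rw [Function.comp_apply, map_smul, map_sub, adjoint_transGroup hα hαβ hw0 hw1]
  · rintro ⟨c, hc⟩
    have h1 := ((transAdj α β w θ φ ψ κ).continuous.tendsto _).comp hc.tendsto
    rw [map_neg, transAdj_adjoint hα hαβ hw0 hw1, ← neg_smul] at h1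
    refine h1.congr fun t => ?_
    rw [Function.comp_apply, map_smul, map_sub, transAdj_adjoint hα hαβ hw0 hw1]
    rfl

/-- Operators commuting with translations preserve primitives. -/
theorem IsPrim.map_of_commute {T : L2R →L[ℂ] L2R} (hT : ∀ t u, T (U0 t u) = U0 t (T u))
    {p r : L2R} {c : ℂ} (h : IsPrim p r fun _ => c) : ∃ c', IsPrim (T p) (T r) fun _ => c' := by
  refine IsPrim.of_tendsto ?_
  have h1 := (T.continuous.tendsto _).comp h.tendsto
  rw [map_neg] at h1
  refine h1.congr fun t => ?_
  rw [Function.comp_apply, map_smul, map_sub, hT]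

theorem inverse_opSide_U0 (hw0 : 0 < w) (κ : Side) (t : ℝ) (u : L2R) :
    Ring.inverse (opSide α β w θ φ ψ κ) (U0 t u) =
      U0 t (Ring.inverse (opSide α β w θ φ ψ κ) u) := by
  conv_lhs => rw [← opSide_inverse hw0 κ u, ← opSide_U0, inverse_opSide hw0]

/-- The inverse of `S*` also commutes with translations, so it preserves the domain of their
generator. -/
theorem IsPrim.of_opSide_adjoint (hw0 : 0 < w) (κ : Side) {p r : L2R} {c : ℂ}
    (h : IsPrim ((opSide α β w θ φ ψ κ).adjoint p) ((opSide α β w θ φ ψ κ).adjoint r)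
      fun _ => c) : ∃ c', IsPrim p r fun _ => c' := by
  set T := opSide α β w θ φ ψ κ with hTdef
  have h1 : ∀ u, (Ring.inverse T).adjoint (T.adjoint u) = u := by
    intro u
    rw [← ContinuousLinearMap.comp_apply, ← ContinuousLinearMap.adjoint_comp,
      show T ∘L Ring.inverse T = ContinuousLinearMap.id ℂ L2R from
        ContinuousLinearMap.ext (opSide_inverse hw0 κ), ContinuousLinearMap.adjoint_id]
    rfl
  have h2 : ∀ t u, (Ring.inverse T).adjoint (U0 t u) = U0 t ((Ring.inverse T).adjoint u) := by
    intro t u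
    have h3 : Ring.inverse T ∘L U0 (-t) = U0 (-t) ∘L Ring.inverse T :=
      ContinuousLinearMap.ext (inverse_opSide_U0 hw0 κ (-t))
    have h4 := congrArg ContinuousLinearMap.adjoint h3
    rw [ContinuousLinearMap.adjoint_comp, ContinuousLinearMap.adjoint_comp, U0_adjoint,
      neg_neg] at h4
    exact (congrArg (fun S : L2R →L[ℂ] L2R => S u) h4).symm
  have h3 := h.map_of_commute h2
  rwa [h1, h1] at h3

/-! ### The domain of the momentum operator and primitives on the line -/

theorem mulVec_bdryMatrix_iff (F : ℝ → ℂ) :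
    (bdryMatrix w θ φ ψ).mulVec ![F 1, F β] = ![F 0, F α] ↔
      F 0 = w * e φ * F 1 - Real.sqrt (1 - w ^ 2) * e (θ - ψ) * F β ∧
      F α = Real.sqrt (1 - w ^ 2) * e ψ * F 1 + w * e (θ - φ) * F β := by
  rw [funext_iff, Fin.forall_fin_two]
  simp [bdryMatrix, Matrix.mulVec, dotProduct, sub_eq_add_neg, eq_comm]

theorem prim_zero (r : ℝ → ℂ) : prim r 0 = 0 := intervalIntegral.integral_same

theorem glue_ae (hα : 1 < α) (hαβ : α < β) (k : L2R) :
    ∀ᵐ x ∂(volume.restrict (Omega α β)),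
      (x < 0 → glue α β w θ φ ψ k x = opA α w φ ψ k x) ∧
      (1 < x → x < α → glue α β w θ φ ψ k x = k x) ∧
      (β < x → glue α β w θ φ ψ k x = opC α β w θ φ ψ k x) := by
  filter_upwards [restr_ae (Omega α β) (cut (measurableSet_Iio (a := (0 : ℝ))) (opA α w φ ψ k) +
      cut (measurableSet_Ioo (a := (1 : ℝ)) (b := α)) k +
      cut (measurableSet_Ioi (a := β)) (opC α β w θ φ ψ k)),
    ae_restrict_of_ae (Lp.coeFn_add (cut (measurableSet_Iio (a := (0 : ℝ))) (opA α w φ ψ k) +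
      cut (measurableSet_Ioo (a := (1 : ℝ)) (b := α)) k)
      (cut (measurableSet_Ioi (a := β)) (opC α β w θ φ ψ k))),
    ae_restrict_of_ae (Lp.coeFn_add (cut (measurableSet_Iio (a := (0 : ℝ))) (opA α w φ ψ k))
      (cut (measurableSet_Ioo (a := (1 : ℝ)) (b := α)) k)),
    ae_restrict_of_ae (cut_ae (measurableSet_Iio (a := (0 : ℝ))) (opA α w φ ψ k)),
    ae_restrict_of_ae (cut_ae (measurableSet_Ioo (a := (1 : ℝ)) (b := α)) k),
    ae_restrict_of_ae (cut_ae (measurableSet_Ioi (a := β)) (opC α β w θ φ ψ k))]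
    with x h1 h2 h3 h4 h5 h6
  have h : glue α β w θ φ ψ k x = (Iio 0).indicator (opA α w φ ψ k) x +
      (Ioo 1 α).indicator k x + (Ioi β).indicator (opC α β w θ φ ψ k) x := by
    rw [← h4, ← h5, ← h6]
    refine h1.trans ?_
    rw [h2, Pi.add_apply, h3, Pi.add_apply]
  rw [h]
  simp only [indicator, mem_Iio, mem_Ioo, mem_Ioi]
  refine ⟨fun hx => ?_, fun hx hx' => ?_, fun hx => ?_⟩
  · rw [if_pos hx, if_neg (by grind), if_neg (by grind), add_zero, add_zero]
  · rw [if_neg (by grind), if_pos ⟨hx, hx'⟩, if_neg (by grind), add_zero, zero_add]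
  · rw [if_neg (by grind), if_neg (by grind), if_pos hx, add_zero, zero_add]

/-- Primitives on the translation side give elements of the domain of the momentum operator. -/
theorem momentumRel_of_isPrim (hα : 1 < α) (hαβ : α < β) (hw0 : 0 < w) (hw1 : w ≤ 1)
    {k k' : L2R} {c : ℂ} (h : IsPrim k k' fun _ => c) {f g : L2Omega α β}
    (hf : glue α β w θ φ ψ k = f)
    (hg : glue α β w θ φ ψ k' = (2 * Real.pi * Complex.I : ℂ) • g) :
    MomentumRel α β (bdryMatrix w θ φ ψ) f g := by
  obtain ⟨cA, hA⟩ := h.map_of_commute (T := opA α w φ ψ) (fun t u => shiftComb_U0 _ _ _ _ t u)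
  obtain ⟨cC, hC⟩ := h.map_of_commute (T := opC α β w θ φ ψ) (fun t u => shiftComb_U0 _ _ _ _ t u)
  have hac : ∀ (c : ℂ) (r : L2R) (a b : ℝ),
      AbsolutelyContinuousOnInterval (fun x => c + prim r x) a b := fun c r a b =>
    (absolutelyContinuous_const c a b).add (absolutelyContinuous_prim r a b)
  -- Each branch contains one whole closed component of the closure of `Ω`, so the values at `0`,
  -- `1`, `α`, `β` are the one-sided limits from `Ω`. Values in the gaps do not matter.
  let F : ℝ → ℂ := fun x => if x ≤ 0 then cA + prim (opA α w φ ψ k') x else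
    if x ≤ α then c + prim k' x else cC + prim (opC α β w θ φ ψ k') x
  have F1 : ∀ x ≤ 0, F x = cA + prim (opA α w φ ψ k') x := fun x hx => if_pos hx
  have F2 : ∀ x, 0 < x → x ≤ α → F x = c + prim k' x := fun x hx hx' => by
    simp only [F]
    rw [if_neg (not_le.2 hx), if_pos hx']
  have F3 : ∀ x, α < x → F x = cC + prim (opC α β w θ φ ψ k') x := fun x hx => by
    simp only [F]
    rw [if_neg (by linarith), if_neg (by linarith)]
  refine ⟨F, ⟨fun x hx => ?_, ?_, fun x hx => ?_⟩, ?_, ?_, ?_⟩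
  · refine absolutelyContinuous_congr (hac _ _ _ _) fun y hy => (F1 y ?_).symm
    rw [uIcc_of_le hx] at hy
    exact hy.2
  · refine absolutelyContinuous_congr (hac _ _ _ _) fun y hy => (F2 y ?_ ?_).symm
    · rw [uIcc_of_le hα.le] at hy
      linarith [hy.1]
    · rw [uIcc_of_le hα.le] at hy
      exact hy.2
  · refine absolutelyContinuous_congr (hac _ _ _ _) fun y hy => (F3 y ?_).symm
    rw [uIcc_of_le hx] at hy
    linarith [hy.1]
  · rw [← hf]
    filter_upwards [glue_ae (w := w) (θ := θ) (φ := φ) (ψ := ψ) hα hαβ k, ae_restrict_of_ae h,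
      ae_restrict_of_ae hA, ae_restrict_of_ae hC, ae_restrict_mem measurableSet_Omega]
      with x h1 h2 h3 h4 hx
    rcases hx with (hx | hx) | hx
    · rw [h1.1 hx, F1 x (le_of_lt hx), h3]
    · rw [h1.2.1 hx.1 hx.2, F2 x (by linarith [hx.1]) hx.2.le, h2]
    · rw [h1.2.2 hx, F3 x (hαβ.trans hx), h4]
  · filter_upwards [glue_ae (w := w) (θ := θ) (φ := φ) (ψ := ψ) hα hαβ k',
      Lp.coeFn_smul (2 * Real.pi * Complex.I : ℂ) g,
      ae_restrict_of_ae (ae_hasDerivAt_prim k'),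
      ae_restrict_of_ae (ae_hasDerivAt_prim (opA α w φ ψ k')),
      ae_restrict_of_ae (ae_hasDerivAt_prim (opC α β w θ φ ψ k')),
      ae_restrict_mem measurableSet_Omega] with x h1 h2 h3 h4 h5 hx
    rw [hg, h2, Pi.smul_apply, smul_eq_mul] at h1
    rcases hx with (hx | hx) | hx
    · rw [h1.1 hx]
      refine (h4.const_add cA).congr_of_eventuallyEq ?_
      filter_upwards [Iio_mem_nhds hx] with y hy using F1 y (le_of_lt hy)
    · rw [h1.2.1 hx.1 hx.2]
      refine (h3.const_add c).congr_of_eventuallyEq ?_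
      filter_upwards [Ioo_mem_nhds hx.1 hx.2] with y hy using F2 y (by linarith [hy.1]) hy.2.le
    · rw [h1.2.2 hx]
      refine (h5.const_add cC).congr_of_eventuallyEq ?_
      filter_upwards [Ioi_mem_nhds hx] with y hy using F3 y (hαβ.trans hy)
  · rw [mulVec_bdryMatrix_iff, F1 0 le_rfl, F2 1 one_pos hα.le, F2 α (by linarith) le_rfl,
      F3 β hαβ]
    -- The translated boundary relations hold almost everywhere between continuous representatives,
    -- hence everywhere; at `x = 0` the translates by `-1`, `-α`, `-β` are evaluated at `1`, `α`,
    -- `β`.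
    have e1 := hA.eq_of_continuous (((h.translate (-1)).smul (w * e φ)).sub
      ((hC.translate (-β)).smul (Real.sqrt (1 - w ^ 2) * e (θ - ψ)))) (opA_eq hw0 hw1 k)
      continuous_const continuous_const 0
    have e2 := (h.translate (-α)).eq_of_continuous
      (((h.translate (-1)).smul (Real.sqrt (1 - w ^ 2) * e ψ)).add
      ((hC.translate (-β)).smul (w * e (θ - φ)))) (U0_eq hw0 k)
      continuous_const continuous_const 0
    simp only [prim_zero, add_zero, neg_neg] at e1 e2
    rw [prim_zero, add_zero]
    exact ⟨e1, e2⟩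

theorem prim_eq_of_ae_zero {r : L2R} {a b : ℝ} (hab : a ≤ b)
    (h : ∀ᵐ x, x ∈ Ioo a b → r x = 0) : prim r a = prim r b := by
  have h1 : ∫ y in a..b, r y = 0 := by
    rw [intervalIntegral.integral_of_le hab, integral_Ioc_eq_integral_Ioo]
    refine (integral_congr_ae ((ae_restrict_iff' measurableSet_Ioo).2 h)).trans ?_
    simp
  rw [← prim_sub_prim, sub_eq_zero] at h1
  exact h1.symm

/-- The three pieces of an element of the domain of the momentum operator are primitives up to
jumps. -/
theorem isPrim_cut_Iio {f g : L2Omega α β} {F : ℝ → ℂ} (hF : IsLocACOnClosure α β F)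
    (hf : f =ᵐ[volume.restrict (Omega α β)] F)
    (hd : ∀ᵐ x ∂(volume.restrict (Omega α β)), HasDerivAt F (g x) x) :
    IsPrim (cut (measurableSet_Iio (a := (0 : ℝ))) (zeroExt measurableSet_Omega f))
      (cut (measurableSet_Iio (a := (0 : ℝ))) (zeroExt measurableSet_Omega g))
      fun x => if x < 0 then F 0 else 0 := by
  have hf' := (ae_restrict_iff' measurableSet_Omega).1 hf
  have hd' := (ae_restrict_iff' measurableSet_Omega).1 hd
  have hg := cut_zeroExt_ae measurableSet_Iio Iio_subset_Omega g
  set r := cut (measurableSet_Iio (a := (0 : ℝ))) (zeroExt measurableSet_Omega g)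
  filter_upwards [hf', cut_zeroExt_ae measurableSet_Iio Iio_subset_Omega f] with x h1 h2
  rw [h2]
  rcases lt_or_ge x 0 with hx | hx
  · rw [indicator_of_mem (mem_Iio.2 hx), h1 (Iio_subset_Omega hx), if_pos hx]
    have := eq_add_prim (r := r) hx.le (hF.1 x hx.le) (by
      filter_upwards [hd', hg] with y h3 h4 hy
      rw [h4, indicator_of_mem (mem_Iio.2 hy.2)]
      exact h3 (Iio_subset_Omega hy.2)) x (left_mem_Icc.2 hx.le) 0 (right_mem_Icc.2 hx.le)
    rw [prim_zero] at this
    linear_combination -this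
  · rw [indicator_of_notMem (notMem_Iio.2 hx), if_neg (not_lt.2 hx), zero_add,
      ← prim_eq_of_ae_zero hx, prim_zero]
    filter_upwards [hg] with y h3 hy
    rw [h3, indicator_of_notMem (notMem_Iio.2 hy.1.le)]

theorem isPrim_cut_Ioi (hα : 1 < α) (hαβ : α < β) {f g : L2Omega α β} {F : ℝ → ℂ}
    (hF : IsLocACOnClosure α β F) (hf : f =ᵐ[volume.restrict (Omega α β)] F)
    (hd : ∀ᵐ x ∂(volume.restrict (Omega α β)), HasDerivAt F (g x) x) :
    IsPrim (cut (measurableSet_Ioi (a := β)) (zeroExt measurableSet_Omega f))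
      (cut (measurableSet_Ioi (a := β)) (zeroExt measurableSet_Omega g))
      fun x => if x < β then 0 else F β := by
  have hf' := (ae_restrict_iff' measurableSet_Omega).1 hf
  have hd' := (ae_restrict_iff' measurableSet_Omega).1 hd
  have hg := cut_zeroExt_ae (measurableSet_Ioi (a := β)) Ioi_subset_Omega g
  set r := cut (measurableSet_Ioi (a := β)) (zeroExt measurableSet_Omega g)
  have hz : ∀ a b, a ≤ b → b ≤ β → prim r a = prim r b := by
    intro a b hab hb
    refine prim_eq_of_ae_zero hab ?_
    filter_upwards [hg] with y h3 hy
    rw [h3, indicator_of_notMem (notMem_Ioi.2 (hy.2.le.trans hb))]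
  have h0 : ∀ b, b ≤ β → prim r b = 0 := by
    intro b hb
    rcases le_total 0 b with h | h
    · rw [← hz 0 b h hb, prim_zero]
    · rw [hz b 0 h (by linarith), prim_zero]
  filter_upwards [hf', cut_zeroExt_ae (measurableSet_Ioi (a := β)) Ioi_subset_Omega f,
    Measure.ae_ne volume β] with x h1 h2 hne
  rw [h2]
  rcases lt_or_gt_of_ne hne with hx | hx
  · rw [indicator_of_notMem (notMem_Ioi.2 hx.le), if_pos hx, zero_add, h0 x hx.le]
  · rw [indicator_of_mem (mem_Ioi.2 hx), h1 (Ioi_subset_Omega hx), if_neg (not_lt.2 hx.le)]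
    have := eq_add_prim (r := r) hx.le (hF.2.2 x hx.le) (by
      filter_upwards [hd', hg] with y h3 h4 hy
      rw [h4, indicator_of_mem (mem_Ioi.2 hy.1)]
      exact h3 (Ioi_subset_Omega hy.1)) β (left_mem_Icc.2 hx.le) x (right_mem_Icc.2 hx.le)
    rw [h0 β le_rfl] at this
    linear_combination this

/-- The jumps are `F 1` at `1` and `-F α` at `α`. Beyond `α` the primitive stays at `F α - F 1`, so
the step value `F 1 - F α` makes the sum vanish there. -/
theorem isPrim_cut_Ioo (hα : 1 < α) {f g : L2Omega α β} {F : ℝ → ℂ}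
    (hF : IsLocACOnClosure α β F) (hf : f =ᵐ[volume.restrict (Omega α β)] F)
    (hd : ∀ᵐ x ∂(volume.restrict (Omega α β)), HasDerivAt F (g x) x) :
    IsPrim (cut (measurableSet_Ioo (a := (1 : ℝ)) (b := α)) (zeroExt measurableSet_Omega f))
      (cut (measurableSet_Ioo (a := (1 : ℝ)) (b := α)) (zeroExt measurableSet_Omega g))
      fun x => if x < 1 then 0 else if x < α then F 1 else F 1 - F α := by
  have hf' := (ae_restrict_iff' measurableSet_Omega).1 hf
  have hd' := (ae_restrict_iff' measurableSet_Omega).1 hd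
  have hg := cut_zeroExt_ae (measurableSet_Ioo (a := (1 : ℝ)) (b := α)) Ioo_subset_Omega g
  set r := cut (measurableSet_Ioo (a := (1 : ℝ)) (b := α)) (zeroExt measurableSet_Omega g)
  have h0 : ∀ b, b ≤ 1 → prim r b = 0 := by
    have hz : ∀ a b, a ≤ b → b ≤ 1 → prim r a = prim r b := by
      intro a b hab hb
      refine prim_eq_of_ae_zero hab ?_
      filter_upwards [hg] with y h3 hy
      rw [h3, indicator_of_notMem (fun h => by linarith [h.1, hy.2])]
    intro b hb
    rcases le_total 0 b with h | h
    · rw [← hz 0 b h hb, prim_zero]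
    · rw [hz b 0 h (by linarith), prim_zero]
  have hin := eq_add_prim (r := r) hα.le hF.2.1 (by
    filter_upwards [hd', hg] with y h3 h4 hy
    rw [h4, indicator_of_mem hy]
    exact h3 (Ioo_subset_Omega hy)) 1 (left_mem_Icc.2 hα.le)
  rw [h0 1 le_rfl] at hin
  filter_upwards [hf', cut_zeroExt_ae (measurableSet_Ioo (a := (1 : ℝ)) (b := α)) Ioo_subset_Omega f,
    Measure.ae_ne volume 1] with x h1 h2 hne
  rw [h2]
  rcases lt_or_gt_of_ne hne with hx | hx
  · rw [indicator_of_notMem (fun h => by linarith [h.1]), if_pos hx, zero_add, h0 x hx.le]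
  · rw [if_neg (not_lt.2 hx.le)]
    rcases lt_or_ge x α with hx' | hx'
    · rw [indicator_of_mem (mem_Ioo.2 ⟨hx, hx'⟩), if_pos hx', h1 (Ioo_subset_Omega ⟨hx, hx'⟩)]
      linear_combination hin x ⟨hx.le, hx'.le⟩
    · rw [indicator_of_notMem (fun h => by linarith [h.2]), if_neg (not_lt.2 hx'),
        ← prim_eq_of_ae_zero hx']
      · linear_combination hin α (right_mem_Icc.2 hα.le)
      · filter_upwards [hg] with y h3 hy
        rw [h3, indicator_of_notMem (fun h => by linarith [h.2, hy.1])]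

/-- Elements of the domain of the momentum operator give primitives: the jumps cancel by the
boundary condition. -/
theorem isPrim_glue_adjoint (hα : 1 < α) (hαβ : α < β) (hw0 : 0 < w) (hw1 : w ≤ 1)
    {f g : L2Omega α β} (h : MomentumRel α β (bdryMatrix w θ φ ψ) f g) :
    ∃ c, IsPrim ((glue α β w θ φ ψ).adjoint f)
      ((glue α β w θ φ ψ).adjoint ((2 * Real.pi * Complex.I : ℂ) • g)) fun _ => c := by
  obtain ⟨F, hF, hf, hd, hB⟩ := h
  rw [mulVec_bdryMatrix_iff] at hB
  obtain ⟨hB1, hB2⟩ := hB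
  have hd' : ∀ᵐ x ∂(volume.restrict (Omega α β)),
      HasDerivAt F (((2 * Real.pi * Complex.I : ℂ) • g : L2Omega α β) x) x := by
    filter_upwards [hd, Lp.coeFn_smul (2 * Real.pi * Complex.I : ℂ) g] with x h1 h2
    rwa [h2]
  have hw : (w : ℂ) ≠ 0 := Complex.ofReal_ne_zero.2 hw0.ne'
  have hs := sq_add_sqrt_sq hw0 hw1
  have p1 := (isPrim_cut_Iio hF hf hd').shiftComb ((w : ℂ)⁻¹ * e (-φ)) 1
    (Real.sqrt (1 - w ^ 2) * e ψ) α
  have p3 := (isPrim_cut_Ioi hα hαβ hF hf hd').shiftComb ((w : ℂ)⁻¹ * e (θ - φ)) (α - β)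
    (Real.sqrt (1 - w ^ 2) * e (-ψ)) (1 - β)
  have p := (p1.add (isPrim_cut_Ioo hα hF hf hd')).add p3
  rw [← opA_adjoint, ← opC_adjoint, ← glue_adjoint, ← glue_adjoint] at p
  have i1 : ∀ x : ℝ, x - 1 < 0 ↔ x < 1 := fun x => by constructor <;> intro <;> linarith
  have i2 : ∀ x : ℝ, x - α < 0 ↔ x < α := fun x => by constructor <;> intro <;> linarith
  have i3 : ∀ x : ℝ, x - (α - β) < β ↔ x < α := fun x => by constructor <;> intro <;> linarith
  have i4 : ∀ x : ℝ, x - (1 - β) < β ↔ x < 1 := fun x => by constructor <;> intro <;> linarith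
  have j1 : e (-φ) * e φ = 1 := by rw [← e_add, neg_add_cancel, e_zero]
  have j2 : e (-φ) * e (θ - ψ) = e (θ - φ) * e (-ψ) := by
    rw [← e_add, ← e_add]; congr 1; ring
  have j3 : e (-φ) * e ψ * e (θ - ψ) = e (θ - φ) := by
    rw [← e_add, ← e_add]; congr 1; ring
  simp only [i1, i2, i3, i4] at p
  -- Vanishing of the total jump at `1`; `hjump2` is the same at `α`. The shifts in `A*` and `C*`
  -- move the jumps at `0` and `β` to precisely these two points.
  have hjump1 : (w : ℂ)⁻¹ * e (-φ) * F 0 = F 1 -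
      (w : ℂ)⁻¹ * e (θ - φ) * (Real.sqrt (1 - w ^ 2) * e (-ψ)) * F β := by
    rw [hB1]
    field_simp
    linear_combination (w : ℂ) * F 1 * j1 - Real.sqrt (1 - w ^ 2) * F β * j2
  have hjump2 : F α = (w : ℂ)⁻¹ * e (-φ) * (Real.sqrt (1 - w ^ 2) * e ψ) * F 0 +
      (w : ℂ)⁻¹ * e (θ - φ) * F β := by
    rw [hB1, hB2]
    field_simp
    linear_combination (-(Real.sqrt (1 - w ^ 2) : ℂ) * w * e ψ * F 1) * j1 +
      ((Real.sqrt (1 - w ^ 2) : ℂ) ^ 2 * F β) * j3 + F β * e (θ - φ) * hs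
  -- The `qᵢ` are the normalization constants produced by translating primitives; they do not depend
  -- on `x`, so only the steps have to cancel.
  obtain ⟨q₁, q₂, q₃, q₄, p⟩ : ∃ q₁ q₂ q₃ q₄ : ℂ, IsPrim ((glue α β w θ φ ψ).adjoint f)
      ((glue α β w θ φ ψ).adjoint ((2 * Real.pi * Complex.I : ℂ) • g)) fun x =>
      (w : ℂ)⁻¹ * e (-φ) * ((if x < 1 then F 0 else 0) + q₁ - Real.sqrt (1 - w ^ 2) * e ψ *
        ((if x < α then F 0 else 0) + q₂)) +
      (if x < 1 then 0 else if x < α then F 1 else F 1 - F α) +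
      (w : ℂ)⁻¹ * e (θ - φ) * ((if x < α then 0 else F β) + q₃ -
        Real.sqrt (1 - w ^ 2) * e (-ψ) * ((if x < 1 then 0 else F β) + q₄)) := ⟨_, _, _, _, p⟩
  refine ⟨(w : ℂ)⁻¹ * e (-φ) * (F 0 + q₁ - Real.sqrt (1 - w ^ 2) * e ψ * (F 0 + q₂)) +
    (w : ℂ)⁻¹ * e (θ - φ) * (q₃ - Real.sqrt (1 - w ^ 2) * e (-ψ) * q₄), ?_⟩
  convert p using 1
  funext x
  rcases lt_or_ge x 1 with hx | hx
  · rw [if_pos hx, if_pos (hx.trans hα), if_pos hx, if_pos (hx.trans hα), if_pos hx]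
    ring
  · rcases lt_or_ge x α with hx' | hx'
    · rw [if_neg (not_lt.2 hx), if_pos hx', if_neg (not_lt.2 hx), if_pos hx', if_pos hx',
        if_neg (not_lt.2 hx)]
      linear_combination hjump1
    · rw [if_neg (not_lt.2 hx), if_neg (not_lt.2 hx'), if_neg (not_lt.2 hx),
        if_neg (not_lt.2 hx'), if_neg (not_lt.2 hx'), if_neg (not_lt.2 hx)]
      linear_combination hjump1 + hjump2

end

end TwoIntervals

/-! ### Identification of `U_B` and the final theorem -/

namespace TwoIntervals

noncomputable section

variable {α β w θ φ ψ : ℝ}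

/-- The transported translation group is generated by the momentum operator. -/
theorem isUnitaryGroupOf_transGroup (hα : 1 < α) (hαβ : α < β) (hw0 : 0 < w) (hw1 : w ≤ 1)
    (κ : Side) : IsUnitaryGroupOf (momentumOp α β (bdryMatrix w θ φ ψ))
      (transGroup α β w θ φ ψ κ) where
  map_zero := transGroup_zero hα hαβ hw0 hw1 κ
  map_add := transGroup_add hα hαβ hw0 hw1 κ
  unitary := transGroup_mem_unitary hα hαβ hw0 hw1 κ
  continuous f := (transAdj α β w θ φ ψ κ).continuous.comp (continuous_U0 _)
  generator f g := by
    rw [mem_momentumOp_graph, tendsto_transGroup_iff hα hαβ hw0 hw1]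
    constructor
    · intro h
      obtain ⟨c, hc⟩ := isPrim_glue_adjoint hα hαβ hw0 hw1 h
      refine IsPrim.of_opSide_adjoint (α := α) (β := β) (θ := θ) (φ := φ) (ψ := ψ) hw0 κ (c := c) ?_
      rwa [opSide_adjoint_transAdj_adjoint hw0, opSide_adjoint_transAdj_adjoint hw0]
    · rintro ⟨c, hc⟩
      -- The function to glue is `k = S⁻¹ T* f`, for which `G k = T T* f = f`.
      obtain ⟨c', hc'⟩ := hc.map_of_commute (inverse_opSide_U0 hw0 κ)
      refine momentumRel_of_isPrim hα hαβ hw0 hw1 hc' ?_ ?_ <;>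
      rw [← ContinuousLinearMap.comp_apply, ← transAdj, transAdj_adjoint hα hαβ hw0 hw1]

theorem isUnitaryGroupOf_UB (hα : 1 < α) (hαβ : α < β) (hw0 : 0 < w) (hw1 : w ≤ 1) :
    IsUnitaryGroupOf (momentumOp α β (bdryMatrix w θ φ ψ)) (UB α β (bdryMatrix w θ φ ψ)) :=
  Classical.epsilon_spec ⟨_, isUnitaryGroupOf_transGroup hα hαβ hw0 hw1 .outgoing⟩

/-- The incoming and outgoing constructions share the generator `P_B`, so uniqueness identifies both
with `U_B`. -/
theorem UB_eq_transGroup (hα : 1 < α) (hαβ : α < β) (hw0 : 0 < w) (hw1 : w ≤ 1) (κ : Side) :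
    UB α β (bdryMatrix w θ φ ψ) = transGroup α β w θ φ ψ κ :=
  (isUnitaryGroupOf_UB hα hαβ hw0 hw1).unique (isUnitaryGroupOf_transGroup hα hαβ hw0 hw1 κ)

end

end TwoIntervals

theorem theorem5p3 (α β w θ φ ψ : ℝ) (hα : 1 < α) (hαβ : α < β) (hw0 : 0 < w) (hw1 : w ≤ 1) :
    -- the group `U_B` is well defined, and is the unitary group generated by `P_B`
    (∃! U, IsUnitaryGroupOf
      (momentumOp α β (bdryMatrix w θ φ ψ)) U) ∧
    IsUnitaryGroupOf
      (momentumOp α β (bdryMatrix w θ φ ψ))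
      (UB α β (bdryMatrix w θ φ ψ)) ∧
    ∀ κ : Side,
      -- the transforms `V_±` are well defined, and are given by the integral formula
      (∃! V : L2Omega α β →L[ℂ] L2R,
        IsTransformOf (normEigenfunction α β w θ φ ψ κ) V) ∧
      IsTransformOf (normEigenfunction α β w θ φ ψ κ)
        (V α β w θ φ ψ κ) ∧
      -- `R_±` is unitary from `L²(Ω)` onto `L²(ℝ)`
      (∀ f, ‖R α β w θ φ ψ κ f‖ = ‖f‖) ∧
      Function.Surjective (R α β w θ φ ψ κ) ∧
      -- `R_±` is the identity on `D_±` (functions on `Ω` being extended by zero to `ℝ`)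
      (∀ f ∈ D α β κ, R α β w θ φ ψ κ f =ᵐ[volume]
        (Omega α β).indicator f) ∧
      -- `U_B(t) = R_±* U_0(t) R_±`
      (∀ t, UB α β (bdryMatrix w θ φ ψ) t =
        (R α β w θ φ ψ κ).adjoint ∘L U0 t ∘L
          R α β w θ φ ψ κ) ∧
      -- the diagram: outer, upper and lower rectangle
      (∀ t, R α β w θ φ ψ κ ∘L
          UB α β (bdryMatrix w θ φ ψ) t =
        U0 t ∘L R α β w θ φ ψ κ) ∧
      (∀ t f, V α β w θ φ ψ κ
          (UB α β (bdryMatrix w θ φ ψ) t f) =ᵐ[volume]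
        fun l => e (-l * t) * V α β w θ φ ψ κ f l) ∧
      (∀ t, ∀ g h : L2R, h =ᵐ[volume] (fun l => e (-l * t) * g l) →
        fourierAdj h = U0 t (fourierAdj g)) := by
  have hU := isUnitaryGroupOf_UB (θ := θ) (φ := φ) (ψ := ψ) hα hαβ hw0 hw1
  refine ⟨⟨_, hU, fun U h => h.unique hU⟩, hU, fun κ => ?_⟩
  have hV := V_spec (α := α) (β := β) (θ := θ) (φ := φ) (ψ := ψ) hw0 κ
  have hR := R_eq (α := α) (β := β) (θ := θ) (φ := φ) (ψ := ψ) hw0 κ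
  have hUB := UB_eq_transGroup (θ := θ) (φ := φ) (ψ := ψ) hα hαβ hw0 hw1 κ
  have hRU : ∀ t f, R α β w θ φ ψ κ (UB α β (bdryMatrix w θ φ ψ) t f) =
      U0 t (R α β w θ φ ψ κ f) := by
    intro t f
    rw [hR, hUB]
    exact adjoint_transGroup hα hαβ hw0 hw1 κ t f
  have hVR : ∀ f, V α β w θ φ ψ κ f = fourierL2 (R α β w θ φ ψ κ f) := by
    intro f
    rw [hR, V_apply hw0]
  refine ⟨⟨_, hV, fun T h => h.unique hV⟩, hV, fun f => ?_, fun u => ?_, fun f hf => ?_, fun t => ?_,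
    fun t => ContinuousLinearMap.ext fun f => hRU t f, fun t f => ?_, fun t g h hgh => ?_⟩
  · rw [hR, ← norm_transAdj (θ := θ) (φ := φ) (ψ := ψ) hα hαβ hw0 hw1 κ,
      transAdj_adjoint hα hαβ hw0 hw1]
  · exact ⟨transAdj α β w θ φ ψ κ u, by rw [hR, adjoint_transAdj hα hαβ hw0 hw1]⟩
  · rw [R_apply_of_mem_D hα hαβ hw0 κ hf]
    exact zeroExt_ae measurableSet_Omega f
  · rw [hR, ContinuousLinearMap.adjoint_adjoint, hUB]
    rfl
  · rw [hVR, hVR, hRU]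
    exact fourierL2_U0_ae t _
  · refine fourierL2.injective ?_
    rw [fourierL2_fourierAdj, fourierL2_U0, fourierL2_fourierAdj]
    exact Lp.ext (hgh.trans (modulation_ae t g).symm)
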